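/- Let $(X_{t,T})_{t\in\mathbb Z,\,T\in\mathbb N^*}$ be an array of real random variables on a probability space with $\mathbb E X_{t,T}=0$ and finite variances $\sigma_{t,T}^2$, satisfying the following assumptions. (1) *Local stationarity*: there are a function $f:\mathbb R^2\to[0,\infty)$, $2\pi$-periodic and locally integrable in its second variable, and a constant $C\ge 0$ such that, with $\gamma_k(u)=\int_{-\pi}^{\pi}e^{ik\lambda}f(u,\lambda)\,d\lambda$, we have $|\mathrm{Cov}(X_{t,T},X_{t-k,T})-\gamma_k(t/T)|\le C/T$ for all $t,k\in\mathbb Z$, $T\in\mathbb N^*$. (2) *Geometric $\alpha$-mixing*: there are $K>0$, $\rho>1$ with $\alpha(n)\le K\rho^{-n}$ for all $n\in\mathbb N$, where $\alpha(n)=\sup_{T\in\mathbb N^*}\sup_{t\in\mathbb Z}\sup\{|\mathbb P(A\cap B)-\mathbb P(A)\mathbb P(B)| : A\in\sigma(X_{s,T}:s\le t),\ B\in\sigma(X_{s,T}:s\ge t+n)\}$. (3) There are constants with $0<m_f\le |f(u,\lambda)|\le M_f$ for all $u,\lambda$. (4) $f$ is continuously differentiable in $u$ and $|\partial_u f(u,\lambda)|\le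 M_f'$ for all $u,\lambda$, for some constant $M_f'\ge0$. (5) *Bernstein-type condition*: there are $c>0$ and $d\ge 1/2$ with $\mathbb E|X_{t,T}|^k\le c^{k-2}(k!)^d\sigma_{t,T}^2$ for $t=1,\dots,T$, $T\in\mathbb N^*$, $k=2,3,\dots$. For $1\le p<N$ and $|k|\le p$ let $$\hat\gamma_{k;N,T}(t)=\frac1{N-|k|}\sum_{\ell=t-N+|k|+1}^{t}X_{\ell-|k|,T}X_{\ell,T},$$ $$\hat\Gamma^{(p)}_{N,T}(t)=[\hat\gamma_{i-j;N,T}(t)]_{i,j=1}^p,\qquad \hat\gamma^{(p)}_{N,T}(t)=(\hat\gamma_{1;N,T}(t),\dots,\hat\gamma_{p;N,T}(t))',$$ and define the localised Yule–Walker estimator and its population counterpart by $$\hat a^{(p)}_{N,T}(t)=\big(\hat\Gamma^{(p)}_{N,T}(t)\big)^{-1}\hat\gamma^{(p)}_{N,T}(t),\qquad \bar a^{(p)}_{N,T}(t)=\big(\mathbb E\hat\Gamma^{(p)}_{N,T}(t)\big)^{-1}\mathbb E\hat\gamma^{(p)}_{N,T}(t).$$ Let $P=P_T$ and $N=N_T$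 be integer sequences with $2\le 1+P\le N\le T$ for all $T\ge 2$, such that $P=o\big(N^{(1+2d)/(4+6d)}\big)$ and $N\to\infty$ as $T\to\infty$, with $d$ from (5). Assume that there is a sequence $R_T\ge 0$ with $R_T\to\infty$ and $R_T\log T=o\big((N/P)^{1/(3+4d)}\big)$ as $T\to\infty$. Then, for all sufficiently large $T$, the matrices $\mathbb E\hat\Gamma^{(p)}_{N,T}(t)$ with $1\le p\le P$ and $N\le t\le T$ are invertible; almost surely, for all sufficiently large $T$, the matrices $\hat\Gamma^{(p)}_{N,T}(t)$ with $1\le p\le P$ and $N\le t\le T$ are invertible; and, with $\|\cdot\|$ the Euclidean norm, $$\sup_{p=1,\dots,P}\ \sup_{t=N,\dots,T}\big\|\hat a^{(p)}_{N,T}(t)-\bar a^{(p)}_{N,T}(t)\big\| = O\Big(P^{3/2}\Big(\frac{\log T}{N}\Big)^{1/2}\Big)\quad\text{almost surely, as } T\to\infty.$$ In particular the localised Yule–Walker estimator is strongly, uniformly consistent, even with diverging order: the supremum on the left tends to $0$ almost surely. -/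

import Mathlib

open MeasureTheory ProbabilityTheory Filter Asymptotics
open scoped Nat

noncomputable section

namespace LocStat

variable {Ω : Type*} [MeasurableSpace Ω]

/-- A local spectral density: a function `f : ℝ² → ℝ₊`, written `f u θ` with local time `u` and
frequency `θ`, which is `2π`-periodic and locally integrable in the frequency. -/
structure IsLocalSpectralDensity (f : ℝ → ℝ → ℝ) : Prop where
  nonneg : ∀ u θ, 0 ≤ f u θ
  periodic : ∀ u, Function.Periodic (f u) (2 * Real.pi)
  locallyIntegrable : ∀ u, LocallyIntegrable (f u) volume

/-- The local covariance function `γ_k(u) = ∫_{-π}^{π} exp(i k θ) f(u, θ) dθ`. -/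
def localCov (f : ℝ → ℝ → ℝ) (k : ℤ) (u : ℝ) : ℂ :=
  ∫ θ in (-Real.pi)..Real.pi, Complex.exp (Complex.I * (k : ℂ) * (θ : ℂ)) * (f u θ : ℂ)

/-- Local stationarity of the array `X t T` (`t ∈ ℤ`, `T ≥ 1`; the index `T = 0` is never used)
with local spectral density `f`: finite variances and
`|Cov(X_{t,T}, X_{t-k,T}) - γ_k(t/T)| ≤ C/T`. -/
structure IsLocallyStationary (μ : Measure Ω) (X : ℤ → ℕ → Ω → ℝ) (f : ℝ → ℝ → ℝ) : Prop where
  measurable : ∀ (t : ℤ) (T : ℕ), 1 ≤ T → Measurable (X t T)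
  finite_variance : ∀ (t : ℤ) (T : ℕ), 1 ≤ T → MemLp (X t T) 2 μ
  spectral : IsLocalSpectralDensity f
  cov_approx : ∃ C : ℝ, 0 ≤ C ∧ ∀ (T : ℕ), 1 ≤ T → ∀ t k : ℤ,
    ‖((cov[X t T, X (t - k) T; μ] : ℝ) : ℂ) - localCov f k ((t : ℝ) / (T : ℝ))‖ ≤ C / (T : ℝ)

/-- The strong mixing coefficient of two σ-algebras,
`sup_{A ∈ m₁, B ∈ m₂} |P(A ∩ B) - P(A) P(B)|`. -/
def alphaCoeff (μ : Measure Ω) (m₁ m₂ : MeasurableSpace Ω) : ℝ :=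
  sSup {r | ∃ A B : Set Ω, MeasurableSet[m₁] A ∧ MeasurableSet[m₂] B ∧
    r = |μ.real (A ∩ B) - μ.real A * μ.real B|}

/-- `σ(X_{s,T} : s ≤ t)`. -/
abbrev sigmaPast (X : ℤ → ℕ → Ω → ℝ) (T : ℕ) (t : ℤ) : MeasurableSpace Ω :=
  ⨆ s : {s : ℤ // s ≤ t}, MeasurableSpace.comap (X s T) inferInstance

/-- `σ(X_{s,T} : s ≥ t)`. -/
abbrev sigmaFuture (X : ℤ → ℕ → Ω → ℝ) (T : ℕ) (t : ℤ) : MeasurableSpace Ω :=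
  ⨆ s : {s : ℤ // t ≤ s}, MeasurableSpace.comap (X s T) inferInstance

/-- The strong mixing coefficient of the array,
`α(n) = sup_{T ≥ 1} sup_{t ∈ ℤ} α(σ(X_{s,T} : s ≤ t), σ(X_{s,T} : s ≥ t + n))`. -/
def mixingCoeff (μ : Measure Ω) (X : ℤ → ℕ → Ω → ℝ) (n : ℕ) : ℝ :=
  sSup {r | ∃ (T : ℕ) (t : ℤ), 1 ≤ T ∧
    r = alphaCoeff μ (sigmaPast X T t) (sigmaFuture X T (t + n))}

/-- Geometric `α`-mixing. -/
def IsGeometricallyMixing (μ : Measure Ω) (X : ℤ → ℕ → Ω → ℝ) : Prop :=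
  ∃ K ρ : ℝ, 0 < K ∧ 1 < ρ ∧ ∀ n : ℕ, mixingCoeff μ X n ≤ K * (ρ ^ n)⁻¹

/-- The local spectral density is bounded from above and away from zero. -/
def IsSpectrallyBounded (f : ℝ → ℝ → ℝ) : Prop :=
  ∃ m M : ℝ, 0 < m ∧ ∀ u θ, m ≤ |f u θ| ∧ |f u θ| ≤ M

/-- The local spectral density is continuously differentiable in local time, with a uniformly
bounded partial derivative. -/
def IsSpectrallySmooth (f : ℝ → ℝ → ℝ) : Prop :=
  (∀ θ, ContDiff ℝ 1 (fun u => f u θ)) ∧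
    ∃ M' : ℝ, 0 ≤ M' ∧ ∀ u θ, |deriv (fun v => f v θ) u| ≤ M'

/-- Bernstein-type condition with exponent `d ≥ 1/2`: for some `c > 0`,
`E|X_{t,T}|^k ≤ c^{k-2} (k!)^d Var(X_{t,T})` for `1 ≤ t ≤ T` and `k ≥ 2`. -/
def BernsteinCondition (μ : Measure Ω) (X : ℤ → ℕ → Ω → ℝ) (d : ℝ) : Prop :=
  1 / 2 ≤ d ∧ ∃ c : ℝ, 0 < c ∧ ∀ (T : ℕ) (t : ℤ), 1 ≤ t → t ≤ (T : ℤ) → ∀ k : ℕ, 2 ≤ k →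
    Integrable (fun ω => |X t T ω| ^ k) μ ∧
    ∫ ω, |X t T ω| ^ k ∂μ ≤ c ^ (k - 2) * ((k ! : ℕ) : ℝ) ^ d * Var[X t T; μ]

/-- The localised empirical autocovariance
`γ̂_{k;N,T}(t) = (N - |k|)⁻¹ ∑_{ℓ = t-N+|k|+1}^{t} X_{ℓ-|k|,T} X_{ℓ,T}`. -/
def empCov (X : ℤ → ℕ → Ω → ℝ) (N T : ℕ) (t k : ℤ) (ω : Ω) : ℝ :=
  (((N : ℝ) - |(k : ℝ)|))⁻¹ *
    ∑ l ∈ Finset.Icc (t - N + |k| + 1) t, X (l - |k|) T ω * X l T ω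

/-- The matrix `Γ̂^{(p)}_{N,T}(t) = [γ̂_{i-j;N,T}(t)]_{i,j = 1,…,p}`. -/
def empGamma (X : ℤ → ℕ → Ω → ℝ) (p N T : ℕ) (t : ℤ) (ω : Ω) : Matrix (Fin p) (Fin p) ℝ :=
  Matrix.of fun i j => empCov X N T t ((i : ℤ) - (j : ℤ)) ω

/-- The vector `γ̂^{(p)}_{N,T}(t) = (γ̂_{1;N,T}(t), …, γ̂_{p;N,T}(t))`. -/
def empGammaVec (X : ℤ → ℕ → Ω → ℝ) (p N T : ℕ) (t : ℤ) (ω : Ω) : Fin p → ℝ :=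
  fun i => empCov X N T t ((i : ℤ) + 1) ω

/-- The entrywise expectation `E Γ̂^{(p)}_{N,T}(t)`. -/
def meanGamma (μ : Measure Ω) (X : ℤ → ℕ → Ω → ℝ) (p N T : ℕ) (t : ℤ) :
    Matrix (Fin p) (Fin p) ℝ :=
  Matrix.of fun i j => ∫ ω, empGamma X p N T t ω i j ∂μ

/-- The entrywise expectation `E γ̂^{(p)}_{N,T}(t)`. -/
def meanGammaVec (μ : Measure Ω) (X : ℤ → ℕ → Ω → ℝ) (p N T : ℕ) (t : ℤ) : Fin p → ℝ :=
  fun i => ∫ ω, empGammaVec X p N T t ω i ∂μ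

/-- The localised Yule–Walker estimator `â^{(p)}_{N,T}(t)`, with the Euclidean norm on `ℝ^p`. -/
def yuleWalker (X : ℤ → ℕ → Ω → ℝ) (p N T : ℕ) (t : ℤ) (ω : Ω) : EuclideanSpace ℝ (Fin p) :=
  WithLp.toLp 2 (Matrix.mulVec (empGamma X p N T t ω)⁻¹ (empGammaVec X p N T t ω))

/-- The population quantity `ā^{(p)}_{N,T}(t) = (E Γ̂^{(p)}_{N,T}(t))⁻¹ E γ̂^{(p)}_{N,T}(t)`. -/
def yuleWalkerBar (μ : Measure Ω) (X : ℤ → ℕ → Ω → ℝ) (p N T : ℕ) (t : ℤ) :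
    EuclideanSpace ℝ (Fin p) :=
  WithLp.toLp 2 (Matrix.mulVec (meanGamma μ X p N T t)⁻¹ (meanGammaVec μ X p N T t))

/-- `sup_{p = 1,…,P} sup_{t = N,…,T} ‖â^{(p)}_{N,T}(t) - ā^{(p)}_{N,T}(t)‖`, a supremum of
finitely many reals. -/
def maxError (μ : Measure Ω) (X : ℤ → ℕ → Ω → ℝ) (P N T : ℕ) (ω : Ω) : ℝ :=
  ⨆ p : Set.Icc 1 P, ⨆ t : Set.Icc N T,
    ‖yuleWalker X (p : ℕ) N T ((t : ℕ) : ℤ) ω - yuleWalkerBar μ X (p : ℕ) N T ((t : ℕ) : ℤ)‖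

end LocStat

end

noncomputable section

namespace LocStat

/-! The estimator solves a linear system whose coefficients are sample autocovariances, so the proof
combines a uniform law for these with a stability bound for the system.

Stochastic part. Put ε = A √(P log T / N). Almost surely, for large T, every sample autocovariance
with lag at most P and N ≤ t ≤ T is within ε of its mean (`exists_ae_eventually_abs_empCov_sub_le`).
For one lag and one t this is a Bernstein inequality. The variables are truncated at a level of
order (log T)^d. The products are grouped into blocks of length q of order at most P log T, and
blocks of the same parity are q apart. The exponential supermartingale of the block sums is compared
with its deterministic counterpart through the mixing coefficients (`measureReal_sum_ge_le`).
Products at lag k ≤ P may be correlated over about k time steps, so a sum of N of them has variance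
of order at most N P; this puts P under the root. All error probabilities are O(T⁻⁴), there are at
most T² pairs of lag and time, and Borel–Cantelli applies.

Deterministic part. Up to entrywise errors O(P/N), the mean matrix is an average over the window of
Toeplitz matrices of spectral densities bounded below by m > 0. Each of those has quadratic form at
least 2πm ‖x‖², and P² = o(N) leaves at least πm for the mean matrix
(`exists_eventually_isCoerciveMatrix_meanGamma`). Geometric mixing makes the mean vector bounded in
ℓ¹ uniformly in p, so the population solution is bounded too.

Conclusion. An entrywise error ε is an operator error at most pε. Coercivity then bounds the
difference of the solutions by a constant times Pε, which is P^{3/2} (log T / N)^{1/2} up to a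
constant (`IsCoerciveMatrix.enorm2_inv_mulVec_sub_le`). The growth conditions give P³ log T = o(N),
hence consistency, and also invertibility of the sample matrices. -/

/-- The strong mixing coefficient of `m₁` and `m₂` is at most `a`. -/
def AlphaLE {Ω : Type*} {mΩ : MeasurableSpace Ω} (μ : Measure Ω) (m₁ m₂ : MeasurableSpace Ω)
    (a : ℝ) : Prop :=
  ∀ A B : Set Ω, MeasurableSet[m₁] A → MeasurableSet[m₂] B →
    |μ.real (A ∩ B) - μ.real A * μ.real B| ≤ a

/-! ### Strong mixing: conditional expectations and covariance inequalities. -/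

section Mixing

variable {Ω : Type*} {m m₁ m₂ mΩ : MeasurableSpace Ω} {μ : Measure Ω}

theorem AlphaLE.mono {m₁' m₂' : MeasurableSpace Ω} {a b : ℝ} (h : AlphaLE μ m₁ m₂ a)
    (h₁ : m₁' ≤ m₁) (h₂ : m₂' ≤ m₂) (hab : a ≤ b) : AlphaLE μ m₁' m₂' b :=
  fun A B hA hB => (h A B (h₁ A hA) (h₂ B hB)).trans hab

theorem abs_measureReal_inter_sub_le_one [IsProbabilityMeasure μ] (A B : Set Ω) :
    |μ.real (A ∩ B) - μ.real A * μ.real B| ≤ 1 := by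
  have h1 : μ.real (A ∩ B) ≤ 1 := measureReal_le_one
  have h2 : μ.real A ≤ 1 := measureReal_le_one
  have h3 : μ.real B ≤ 1 := measureReal_le_one
  have h4 : 0 ≤ μ.real (A ∩ B) := measureReal_nonneg
  have h5 : 0 ≤ μ.real A := measureReal_nonneg
  have h6 : 0 ≤ μ.real B := measureReal_nonneg
  rw [abs_le]
  constructor <;> nlinarith [mul_nonneg h5 h6, mul_le_one₀ h2 h6 h3]

theorem alphaLE_one [IsProbabilityMeasure μ] : AlphaLE μ m₁ m₂ 1 :=
  fun A B _ _ => abs_measureReal_inter_sub_le_one A B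

/-- Pull-out property in integrated form. -/
theorem integral_mul_condExp [IsFiniteMeasure μ] (hm : m ≤ mΩ) {H W : Ω → ℝ} {C : ℝ}
    (hH : StronglyMeasurable[m] H) (hC : ∀ᵐ ω ∂μ, |H ω| ≤ C) (hW : Integrable W μ) :
    ∫ ω, H ω * (μ[W|m]) ω ∂μ = ∫ ω, H ω * W ω ∂μ := by
  have hHW : Integrable (H * W) μ := hW.bdd_mul (hH.mono hm).aestronglyMeasurable hC
  have h := condExp_mul_of_stronglyMeasurable_left hH hHW hW
  have h2 : ∫ ω, (μ[H * W|m]) ω ∂μ = ∫ ω, (H * W) ω ∂μ := integral_condExp hm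
  rw [integral_congr_ae h] at h2
  exact h2

/-- The sign of `g` splits the space into two `m`-measurable sets, each of which contributes at most
`c`. This converts bounds over events into L¹ bounds. -/
theorem integral_abs_le_of_setIntegral_le (hm : m ≤ mΩ) {g : Ω → ℝ} {c : ℝ}
    (hg : StronglyMeasurable[m] g) (hgi : Integrable g μ)
    (h : ∀ B, MeasurableSet[m] B → |∫ ω in B, g ω ∂μ| ≤ c) : ∫ ω, |g ω| ∂μ ≤ 2 * c := by
  have hB : MeasurableSet[m] {ω | 0 ≤ g ω} :=
    hg.measurable measurableSet_Ici
  rw [← integral_add_compl (hm _ hB) hgi.abs]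
  have h1 : ∫ ω in {ω | 0 ≤ g ω}, |g ω| ∂μ = ∫ ω in {ω | 0 ≤ g ω}, g ω ∂μ :=
    setIntegral_congr_fun (hm _ hB) fun ω hω => abs_of_nonneg hω
  have h2 : ∫ ω in {ω | 0 ≤ g ω}ᶜ, |g ω| ∂μ = ∫ ω in {ω | 0 ≤ g ω}ᶜ, -g ω ∂μ :=
    setIntegral_congr_fun (hm _ hB).compl fun ω hω => abs_of_neg (not_le.1 hω)
  rw [h1, h2, integral_neg]
  have h3 := abs_le.1 (h _ hB)
  have h4 := abs_le.1 (h _ hB.compl)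
  linarith

/-- Integrated over B in `m₂`, the difference equals P(A ∩ B) - P(A) P(B), which is what mixing
controls. -/
theorem AlphaLE.integral_abs_condExp_indicator_sub_le [IsProbabilityMeasure μ] (hm₁ : m₁ ≤ mΩ)
    (hm₂ : m₂ ≤ mΩ) {a : ℝ} (h : AlphaLE μ m₁ m₂ a) {A : Set Ω} (hA : MeasurableSet[m₁] A) :
    ∫ ω, |(μ[A.indicator (fun _ => (1 : ℝ))|m₂]) ω - μ.real A| ∂μ ≤ 2 * a := by
  have hi : Integrable (A.indicator fun _ => (1 : ℝ)) μ :=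
    (integrable_const _).indicator (hm₁ _ hA)
  refine integral_abs_le_of_setIntegral_le hm₂
    (stronglyMeasurable_condExp.sub stronglyMeasurable_const)
    (integrable_condExp.sub (integrable_const _)) fun B hB => ?_
  rw [integral_sub integrable_condExp.integrableOn (integrable_const _).integrableOn,
    setIntegral_condExp hm₂ hi hB, setIntegral_indicator (hm₁ _ hA)]
  simp only [integral_const, smul_eq_mul, mul_one, measureReal_restrict_apply_univ]
  rw [Set.inter_comm, mul_comm]
  exact h A B hA hB

/-- The conditional expectation of a bounded variable given a weakly dependent σ-algebra is close
to its mean. -/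
theorem AlphaLE.integral_abs_condExp_sub_le [IsProbabilityMeasure μ] (hm₁ : m₁ ≤ mΩ)
    (hm₂ : m₂ ≤ mΩ) {a M : ℝ} (h : AlphaLE μ m₁ m₂ a) {V : Ω → ℝ}
    (hV : StronglyMeasurable[m₂] V) (hM : ∀ ω, |V ω| ≤ M) :
    ∫ ω, |(μ[V|m₁]) ω - ∫ ω', V ω' ∂μ| ∂μ ≤ 4 * M * a := by
  have hVi : Integrable V μ :=
    Integrable.of_bound (hV.mono hm₂).aestronglyMeasurable M (ae_of_all _ hM)
  have key : ∀ B, MeasurableSet[m₁] B →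
      |∫ ω in B, ((μ[V|m₁]) ω - ∫ ω', V ω' ∂μ) ∂μ| ≤ 2 * M * a := by
    intro B hB
    have hi : Integrable (B.indicator fun _ => (1 : ℝ)) μ :=
      (integrable_const _).indicator (hm₁ _ hB)
    -- Duality: the conditioning moves from `V` to the indicator of `B`, for which the L¹ bound is
    -- known. Each of the two passages to L¹ costs a factor 2, whence the 4.
    have e1 : ∫ ω in B, ((μ[V|m₁]) ω - ∫ ω', V ω' ∂μ) ∂μ =
        ∫ ω, V ω * ((μ[B.indicator (fun _ => (1 : ℝ))|m₂]) ω - μ.real B) ∂μ := by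
      rw [integral_sub integrable_condExp.integrableOn (integrable_const _).integrableOn,
        setIntegral_condExp hm₁ hVi hB]
      simp_rw [mul_sub]
      rw [integral_sub (integrable_condExp.bdd_mul (hV.mono hm₂).aestronglyMeasurable
        (ae_of_all _ hM)) (hVi.mul_const _), integral_mul_condExp hm₂ hV (ae_of_all _ hM) hi,
        integral_mul_const]
      simp only [integral_const, smul_eq_mul, measureReal_restrict_apply_univ]
      rw [← integral_indicator (hm₁ _ hB), mul_comm]
      congr 2
      ext ω
      by_cases hω : ω ∈ B <;> simp [hω]
    rw [e1]
    have hgi : Integrable (fun ω => |(μ[B.indicator (fun _ => (1 : ℝ))|m₂]) ω - μ.real B|) μ :=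
      (integrable_condExp.sub (integrable_const _)).abs
    have hM0 : 0 ≤ M := by
      obtain ⟨ω⟩ : Nonempty Ω := μ.nonempty_of_neZero
      exact (abs_nonneg _).trans (hM ω)
    calc _ ≤ ∫ ω, |V ω * ((μ[B.indicator (fun _ => (1 : ℝ))|m₂]) ω - μ.real B)| ∂μ :=
          abs_integral_le_integral_abs
      _ ≤ ∫ ω, M * |(μ[B.indicator (fun _ => (1 : ℝ))|m₂]) ω - μ.real B| ∂μ := by
          refine integral_mono_of_nonneg (ae_of_all _ fun _ => abs_nonneg _) (hgi.const_mul _)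
            (ae_of_all _ fun ω => ?_)
          simp only [abs_mul]
          exact mul_le_mul_of_nonneg_right (hM ω) (abs_nonneg _)
      _ ≤ 2 * M * a := by
          rw [integral_const_mul]
          have := mul_le_mul_of_nonneg_left
            (h.integral_abs_condExp_indicator_sub_le hm₁ hm₂ hB) hM0
          linarith
  have := integral_abs_le_of_setIntegral_le hm₁
    (stronglyMeasurable_condExp.sub stronglyMeasurable_const)
    (integrable_condExp.sub (integrable_const _)) key
  simp only [Pi.sub_apply] at this
  linarith

/-- Covariance inequality for bounded variables. -/
theorem AlphaLE.abs_integral_mul_sub_le [IsProbabilityMeasure μ] (hm₁ : m₁ ≤ mΩ)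
    (hm₂ : m₂ ≤ mΩ) {a L M : ℝ} (h : AlphaLE μ m₁ m₂ a) {U V : Ω → ℝ}
    (hU : StronglyMeasurable[m₁] U) (hL : ∀ ω, |U ω| ≤ L)
    (hV : StronglyMeasurable[m₂] V) (hM : ∀ ω, |V ω| ≤ M) :
    |∫ ω, U ω * V ω ∂μ - (∫ ω, U ω ∂μ) * ∫ ω, V ω ∂μ| ≤ 4 * L * M * a := by
  have hVi : Integrable V μ :=
    Integrable.of_bound (hV.mono hm₂).aestronglyMeasurable M (ae_of_all _ hM)
  have hUi : Integrable U μ :=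
    Integrable.of_bound (hU.mono hm₁).aestronglyMeasurable L (ae_of_all _ hL)
  have hL0 : 0 ≤ L := by
    obtain ⟨ω⟩ : Nonempty Ω := μ.nonempty_of_neZero
    exact (abs_nonneg _).trans (hL ω)
  have e1 : ∫ ω, U ω * V ω ∂μ - (∫ ω, U ω ∂μ) * ∫ ω, V ω ∂μ =
      ∫ ω, U ω * ((μ[V|m₁]) ω - ∫ ω', V ω' ∂μ) ∂μ := by
    simp_rw [mul_sub]
    rw [integral_sub (integrable_condExp.bdd_mul (hU.mono hm₁).aestronglyMeasurable
      (ae_of_all _ hL)) (hUi.mul_const _), integral_mul_condExp hm₁ hU (ae_of_all _ hL) hVi,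
      integral_mul_const]
  rw [e1]
  have hgi : Integrable (fun ω => |(μ[V|m₁]) ω - ∫ ω', V ω' ∂μ|) μ :=
    (integrable_condExp.sub (integrable_const _)).abs
  calc _ ≤ ∫ ω, |U ω * ((μ[V|m₁]) ω - ∫ ω', V ω' ∂μ)| ∂μ := abs_integral_le_integral_abs
    _ ≤ ∫ ω, L * |(μ[V|m₁]) ω - ∫ ω', V ω' ∂μ| ∂μ := by
        refine integral_mono_of_nonneg (ae_of_all _ fun _ => abs_nonneg _) (hgi.const_mul _)
          (ae_of_all _ fun ω => ?_)
        simp only [abs_mul]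
        exact mul_le_mul_of_nonneg_right (hL ω) (abs_nonneg _)
    _ ≤ 4 * L * M * a := by
        rw [integral_const_mul]
        have := mul_le_mul_of_nonneg_left (h.integral_abs_condExp_sub_le hm₁ hm₂ hV hM) hL0
        linarith

/-- Truncation of a real number to `[-L, L]`. -/
def clamp (L x : ℝ) : ℝ := max (-L) (min L x)

theorem measurable_clamp (L : ℝ) : Measurable (clamp L) := by
  unfold clamp; fun_prop

theorem abs_clamp_le {L : ℝ} (hL : 0 ≤ L) (x : ℝ) : |clamp L x| ≤ L := by
  unfold clamp
  rw [abs_le]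
  exact ⟨le_max_left _ _, max_le (by linarith) (min_le_left _ _)⟩

theorem clamp_eq_self {L x : ℝ} (h : |x| ≤ L) : clamp L x = x := by
  unfold clamp
  rw [abs_le] at h
  rw [min_eq_right h.2, max_eq_right h.1]

theorem abs_clamp_le_abs {L : ℝ} (hL : 0 ≤ L) (x : ℝ) : |clamp L x| ≤ |x| := by
  rcases le_total |x| L with h | h
  · rw [clamp_eq_self h]
  · exact (abs_clamp_le hL x).trans h

theorem abs_sub_clamp_le_abs {L : ℝ} (hL : 0 ≤ L) (x : ℝ) : |x - clamp L x| ≤ |x| := by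
  unfold clamp
  rcases abs_cases x with ⟨h, h'⟩ | ⟨h, h'⟩ <;> rw [h, abs_le] <;>
    rcases max_cases (-L) (min L x) with ⟨h1, h2⟩ | ⟨h1, h2⟩ <;>
    rcases min_cases L x with ⟨h3, h4⟩ | ⟨h3, h4⟩ <;> constructor <;> linarith

theorem abs_sub_clamp_le {L : ℝ} (hL : 0 < L) (x : ℝ) : |x - clamp L x| ≤ x ^ 2 / L := by
  rcases le_total |x| L with h | h
  · rw [clamp_eq_self h, sub_self, abs_zero]; positivity
  · refine (abs_sub_clamp_le_abs hL.le x).trans ?_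
    rw [le_div_iff₀ hL, ← sq_abs]
    nlinarith [abs_nonneg x]

theorem integrable_of_sq [IsFiniteMeasure μ] {U : Ω → ℝ} (hU : AEStronglyMeasurable U μ)
    (h : Integrable (fun ω => U ω ^ 2) μ) : Integrable U μ := by
  refine (h.add (integrable_const 1)).mono' hU (ae_of_all _ fun ω => ?_)
  simp only [Pi.add_apply, Real.norm_eq_abs]
  rw [← sq_abs]
  nlinarith [abs_nonneg (U ω), sq_nonneg (|U ω| - 1)]

theorem integrable_sq_of_pow_four [IsFiniteMeasure μ] {U : Ω → ℝ} (hU : AEStronglyMeasurable U μ)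
    (h : Integrable (fun ω => U ω ^ 4) μ) : Integrable (fun ω => U ω ^ 2) μ :=
  integrable_of_sq (hU.pow 2) (h.congr (ae_of_all _ fun ω => by ring))

theorem integrable_mul_of_sq {U V : Ω → ℝ} (hU : AEStronglyMeasurable U μ)
    (hV : AEStronglyMeasurable V μ) (h : Integrable (fun ω => U ω ^ 2) μ)
    (h' : Integrable (fun ω => V ω ^ 2) μ) : Integrable (fun ω => U ω * V ω) μ := by
  refine (h.add h').mono' (hU.mul hV) (ae_of_all _ fun ω => ?_)
  simp only [Pi.add_apply, Real.norm_eq_abs]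
  rw [abs_le]
  constructor <;> nlinarith [sq_nonneg (U ω - V ω), sq_nonneg (U ω + V ω)]

/-- Covariance inequality for variables with finite fourth moments. -/
theorem AlphaLE.abs_integral_mul_sub_le_of_pow_four [IsProbabilityMeasure μ] (hm₁ : m₁ ≤ mΩ)
    (hm₂ : m₂ ≤ mΩ) {K δ κ : ℝ} (hδ : 0 < δ) (h : AlphaLE μ m₁ m₂ (K * δ ^ 3)) {U V : Ω → ℝ}
    (hU : StronglyMeasurable[m₁] U) (hV : StronglyMeasurable[m₂] V)
    (hU4 : Integrable (fun ω => U ω ^ 4) μ) (hV4 : Integrable (fun ω => V ω ^ 4) μ)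
    (hUκ : ∫ ω, U ω ^ 4 ∂μ ≤ κ) (hVκ : ∫ ω, V ω ^ 4 ∂μ ≤ κ) :
    |∫ ω, U ω * V ω ∂μ - (∫ ω, U ω ∂μ) * ∫ ω, V ω ∂μ| ≤ (4 * K + 4 * (1 + κ) ^ 2) * δ := by
  -- Truncation at δ⁻¹ balances the errors: the clamped covariance costs 4 L² K δ³ = 4 K δ, and
  -- fourth moments make the truncation error O(1/L) = O(δ). Hence the cube in the mixing
  -- hypothesis.
  set L := δ⁻¹ with hLdef
  have hL : 0 < L := inv_pos.2 hδ
  have hUm := (hU.mono hm₁).aestronglyMeasurable (μ := μ)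
  have hVm := (hV.mono hm₂).aestronglyMeasurable (μ := μ)
  have hκ : 0 ≤ κ := (integral_nonneg fun ω => by positivity).trans hUκ
  set U₁ := fun ω => clamp L (U ω) with hU₁
  set V₁ := fun ω => clamp L (V ω) with hV₁
  have mU₁ : StronglyMeasurable[m₁] U₁ :=
    ((measurable_clamp L).comp hU.measurable).stronglyMeasurable
  have mV₁ : StronglyMeasurable[m₂] V₁ :=
    ((measurable_clamp L).comp hV.measurable).stronglyMeasurable
  have hcl := h.abs_integral_mul_sub_le hm₁ hm₂ mU₁ (fun ω => abs_clamp_le hL.le _) mV₁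
    (fun ω => abs_clamp_le hL.le _)
  have hU2 := integrable_sq_of_pow_four hUm hU4
  have hV2 := integrable_sq_of_pow_four hVm hV4
  have hUi := integrable_of_sq hUm hU2
  have hVi := integrable_of_sq hVm hV2
  have hUV := integrable_mul_of_sq hUm hVm hU2 hV2
  have mU₁' := (mU₁.mono hm₁).aestronglyMeasurable (μ := μ)
  have mV₁' := (mV₁.mono hm₂).aestronglyMeasurable (μ := μ)
  have hU₁i : Integrable U₁ μ :=
    Integrable.of_bound mU₁' L (ae_of_all _ fun ω => abs_clamp_le hL.le _)
  have hV₁i : Integrable V₁ μ :=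
    Integrable.of_bound mV₁' L (ae_of_all _ fun ω => abs_clamp_le hL.le _)
  have hUV₁ : Integrable (fun ω => U₁ ω * V₁ ω) μ :=
    hV₁i.bdd_mul mU₁' (ae_of_all _ fun ω => abs_clamp_le hL.le _)
  have b1 : |∫ ω, U ω * V ω ∂μ - ∫ ω, U₁ ω * V₁ ω ∂μ| ≤ (1 + 2 * κ) * δ := by
    rw [← integral_sub hUV hUV₁]
    refine abs_integral_le_integral_abs.trans ?_
    have : ∫ ω, |U ω * V ω - U₁ ω * V₁ ω| ∂μ ≤ ∫ ω, (1 + U ω ^ 4 + V ω ^ 4) * δ ∂μ := by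
      refine integral_mono_of_nonneg (ae_of_all _ fun _ => abs_nonneg _)
        ((((integrable_const 1).add hU4).add hV4).mul_const _) (ae_of_all _ fun ω => ?_)
      have e : U ω * V ω - U₁ ω * V₁ ω = (U ω - U₁ ω) * V ω + U₁ ω * (V ω - V₁ ω) := by ring
      have h1 : |U ω - U₁ ω| ≤ U ω ^ 2 * δ := by
        simpa [hLdef] using abs_sub_clamp_le hL (U ω)
      have h2 : |V ω - V₁ ω| ≤ V ω ^ 2 * δ := by
        simpa [hLdef] using abs_sub_clamp_le hL (V ω)
      have h3 : |U₁ ω| ≤ |U ω| := abs_clamp_le_abs hL.le _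
      simp only
      rw [e]
      refine (abs_add_le _ _).trans ?_
      rw [abs_mul, abs_mul]
      have h4 : |U ω - U₁ ω| * |V ω| ≤ U ω ^ 2 * δ * |V ω| :=
        mul_le_mul_of_nonneg_right h1 (abs_nonneg _)
      have h5 : |U₁ ω| * |V ω - V₁ ω| ≤ |U ω| * (V ω ^ 2 * δ) :=
        mul_le_mul h3 h2 (abs_nonneg _) (abs_nonneg _)
      have h6 : U ω ^ 2 * |V ω| + |U ω| * V ω ^ 2 ≤ 1 + U ω ^ 4 + V ω ^ 4 := by
        have e1 : U ω ^ 4 = |U ω| ^ 4 := by rw [← abs_pow, abs_of_nonneg (by positivity)]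
        have e2 : V ω ^ 4 = |V ω| ^ 4 := by rw [← abs_pow, abs_of_nonneg (by positivity)]
        rw [e1, e2, ← sq_abs, ← sq_abs (V ω)]
        set x := |U ω|
        set y := |V ω|
        nlinarith [sq_nonneg (x ^ 2 - y), sq_nonneg (y ^ 2 - x), sq_nonneg (x ^ 2 - 1 / 2),
          sq_nonneg (y ^ 2 - 1 / 2)]
      have := mul_le_mul_of_nonneg_right h6 hδ.le
      linarith
    refine this.trans ?_
    have h14 : Integrable (fun ω => 1 + U ω ^ 4) μ := (integrable_const 1).add hU4
    rw [integral_mul_const, integral_add h14 hV4, integral_add (integrable_const 1) hU4]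
    refine mul_le_mul_of_nonneg_right ?_ hδ.le
    simp only [integral_const, probReal_univ, smul_eq_mul, mul_one]
    linarith
  have hb2 : ∀ W : Ω → ℝ, Integrable W μ → Integrable (fun ω => clamp L (W ω)) μ →
      Integrable (fun ω => W ω ^ 2) μ → Integrable (fun ω => W ω ^ 4) μ →
      (∫ ω, W ω ^ 4 ∂μ ≤ κ) →
      |∫ ω, W ω ∂μ - ∫ ω, clamp L (W ω) ∂μ| ≤ (1 + κ) / 2 * δ ∧ |∫ ω, W ω ∂μ| ≤ 1 + κ ∧
        |∫ ω, clamp L (W ω) ∂μ| ≤ 1 + κ := by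
    intro W hW hWc hW2 hW4 hWκ
    have s1 : ∫ ω, |W ω| ∂μ ≤ 1 + κ := by
      have : ∫ ω, |W ω| ∂μ ≤ ∫ ω, (1 + W ω ^ 4) ∂μ := by
        refine integral_mono_of_nonneg (ae_of_all _ fun _ => abs_nonneg _)
          ((integrable_const 1).add hW4) (ae_of_all _ fun ω => ?_)
        have e1 : W ω ^ 4 = |W ω| ^ 4 := by rw [← abs_pow, abs_of_nonneg (by positivity)]
        simp only
        rw [e1]
        nlinarith [sq_nonneg (|W ω| - 1), sq_nonneg (|W ω| ^ 2 - 1 / 2)]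
      refine this.trans ?_
      rw [integral_add (integrable_const 1) hW4]
      simp only [integral_const, probReal_univ, smul_eq_mul, mul_one]
      linarith
    refine ⟨?_, abs_integral_le_integral_abs.trans s1, abs_integral_le_integral_abs.trans
      ((integral_mono hWc.abs hW.abs fun ω => abs_clamp_le_abs hL.le _).trans s1)⟩
    rw [← integral_sub hW hWc]
    refine abs_integral_le_integral_abs.trans ?_
    have : ∫ ω, |W ω - clamp L (W ω)| ∂μ ≤ ∫ ω, (1 + W ω ^ 4) / 2 * δ ∂μ := by
      refine integral_mono_of_nonneg (ae_of_all _ fun _ => abs_nonneg _)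
        ((((integrable_const 1).add hW4).div_const 2).mul_const δ) (ae_of_all _ fun ω => ?_)
      have h1 : |W ω - clamp L (W ω)| ≤ W ω ^ 2 * δ := by
        simpa [hLdef] using abs_sub_clamp_le hL (W ω)
      refine h1.trans (mul_le_mul_of_nonneg_right ?_ hδ.le)
      nlinarith [sq_nonneg (W ω ^ 2 - 1)]
    refine this.trans ?_
    rw [integral_mul_const, integral_div, integral_add (integrable_const 1) hW4]
    refine mul_le_mul_of_nonneg_right ?_ hδ.le
    simp only [integral_const, probReal_univ, smul_eq_mul, mul_one]
    linarith
  obtain ⟨bU, bU', bU''⟩ := hb2 U hUi hU₁i hU2 hU4 hUκ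
  obtain ⟨bV, bV', bV''⟩ := hb2 V hVi hV₁i hV2 hV4 hVκ
  have b3 : |(∫ ω, U ω ∂μ) * ∫ ω, V ω ∂μ - (∫ ω, U₁ ω ∂μ) * ∫ ω, V₁ ω ∂μ| ≤
      (1 + κ) ^ 2 * δ := by
    have e : (∫ ω, U ω ∂μ) * ∫ ω, V ω ∂μ - (∫ ω, U₁ ω ∂μ) * ∫ ω, V₁ ω ∂μ =
      (∫ ω, U ω ∂μ - ∫ ω, U₁ ω ∂μ) * ∫ ω, V ω ∂μ +
        (∫ ω, U₁ ω ∂μ) * (∫ ω, V ω ∂μ - ∫ ω, V₁ ω ∂μ) := by ring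
    rw [e]
    refine (abs_add_le _ _).trans ?_
    rw [abs_mul, abs_mul]
    have h1 := mul_le_mul bU bV' (abs_nonneg _) (by positivity)
    have h2 := mul_le_mul bU'' bV (abs_nonneg _) (by positivity)
    refine (add_le_add h1 h2).trans (le_of_eq ?_)
    ring
  have hLL : 4 * L * L * (K * δ ^ 3) = 4 * K * δ := by
    rw [hLdef]; field_simp
  rw [hLL] at hcl
  rw [abs_le] at hcl b1 b3 ⊢
  have : (1 + 2 * κ) * δ + (1 + κ) ^ 2 * δ ≤ 4 * (1 + κ) ^ 2 * δ := by
    rw [← add_mul]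
    exact mul_le_mul_of_nonneg_right (by nlinarith) hδ.le
  constructor <;> linarith [hcl.1, hcl.2, b1.1, b1.2, b3.1, b3.2]

end Mixing

/-! ### Exponential inequalities for weakly dependent bounded variables. -/

section Exponential

variable {Ω : Type*} {mΩ : MeasurableSpace Ω} {μ : Measure Ω}

theorem abs_condExp_le {m : MeasurableSpace Ω} {f : Ω → ℝ} {b : ℝ}
    (h : ∀ ω, |f ω| ≤ b) : ∀ᵐ ω ∂μ, |(μ[f|m]) ω| ≤ b :=
  ae_bdd_abs_condExp_of_ae_bdd_abs (ae_of_all _ h)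

/-- The predictable compensator in the exponential supermartingale of the sums of `W`. -/
def compensator (μ : Measure Ω) (F : ℕ → MeasurableSpace Ω) (W : ℕ → Ω → ℝ) (s : ℝ) (j : ℕ)
    (ω : Ω) : ℝ :=
  s * (μ[W j|F j]) ω + s ^ 2 * (μ[fun ω => W j ω ^ 2|F j]) ω

variable {F G : ℕ → MeasurableSpace Ω} {W : ℕ → Ω → ℝ} {s b : ℝ}

theorem stronglyMeasurable_compensator (j : ℕ) :
    StronglyMeasurable[F j] (compensator μ F W s j) :=
  (stronglyMeasurable_condExp.const_mul s).add (stronglyMeasurable_condExp.const_mul (s ^ 2))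

theorem abs_compensator_le (hb : 0 ≤ b) (hWb : ∀ j ω, |W j ω| ≤ b) (hs : 0 ≤ s)
    (hsb : s * b ≤ 1) (j : ℕ) : ∀ᵐ ω ∂μ, |compensator μ F W s j ω| ≤ 2 := by
  have h2 : ∀ ω, |W j ω ^ 2| ≤ b ^ 2 := fun ω => by
    rw [abs_pow]; exact pow_le_pow_left₀ (abs_nonneg _) (hWb j ω) 2
  filter_upwards [abs_condExp_le (μ := μ) (m := F j) (hWb j),
    abs_condExp_le (μ := μ) (m := F j) h2] with ω h1 h2
  unfold compensator
  refine (abs_add_le _ _).trans ?_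
  rw [abs_mul, abs_mul, abs_of_nonneg hs, abs_of_nonneg (sq_nonneg s)]
  have h3 := mul_le_mul_of_nonneg_left h1 hs
  have h4 := mul_le_mul_of_nonneg_left h2 (sq_nonneg s)
  have h5 : s ^ 2 * b ^ 2 ≤ 1 := by
    rw [← mul_pow]; exact pow_le_one₀ (by positivity) hsb
  linarith

variable [IsProbabilityMeasure μ]

/-- For |x| ≤ 1, exp x ≤ 1 + x + x². Conditionally on `F n` this gives E exp(sW) ≤ 1 + g ≤ exp g
with g the compensator, so the exponentials form a supermartingale starting at 1. The argument runs
at the level of integrals: the past factor `H` is `F n`-measurable and can be pulled out. -/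
theorem integral_exp_sum_sub_compensator_le (hF : Monotone F) (hle : ∀ j, F j ≤ mΩ)
    (hW : ∀ j, StronglyMeasurable[F (j + 1)] (W j)) (hb : 0 ≤ b) (hWb : ∀ j ω, |W j ω| ≤ b)
    (hs : 0 ≤ s) (hsb : s * b ≤ 1) (n : ℕ) :
    Integrable (fun ω => Real.exp (∑ j ∈ Finset.range n, (s * W j ω - compensator μ F W s j ω)))
      μ ∧
    ∫ ω, Real.exp (∑ j ∈ Finset.range n, (s * W j ω - compensator μ F W s j ω)) ∂μ ≤ 1 := by
  have hsW : ∀ j ω, |s * W j ω| ≤ 1 := fun j ω => by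
    rw [abs_mul, abs_of_nonneg hs]
    exact (mul_le_mul_of_nonneg_left (hWb j ω) hs).trans hsb
  have hsm : ∀ n, StronglyMeasurable[F n]
      (fun ω => Real.exp (∑ j ∈ Finset.range n, (s * W j ω - compensator μ F W s j ω))) := by
    intro n
    refine Real.continuous_exp.comp_stronglyMeasurable
      (Finset.stronglyMeasurable_fun_sum _ fun j hj => ?_)
    have hj' := Finset.mem_range.1 hj
    exact (((hW j).mono (hF hj')).const_mul s).sub
      ((stronglyMeasurable_compensator j).mono (hF hj'.le))
  have hbd : ∀ n, ∀ᵐ ω ∂μ,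
      |Real.exp (∑ j ∈ Finset.range n, (s * W j ω - compensator μ F W s j ω))| ≤
        Real.exp (3 * n) := by
    intro n
    have := ae_all_iff.2 fun j => abs_compensator_le (μ := μ) (F := F) hb hWb hs hsb j
    filter_upwards [this] with ω hω
    rw [abs_of_pos (Real.exp_pos _), Real.exp_le_exp]
    calc _ ≤ ∑ j ∈ Finset.range n, (3 : ℝ) := Finset.sum_le_sum fun j _ => by
          have h1 := abs_le.1 (hω j)
          have h2 := abs_le.1 (hsW j ω)
          linarith
      _ = 3 * n := by simp [mul_comm]
  have hint : ∀ n, Integrable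
      (fun ω => Real.exp (∑ j ∈ Finset.range n, (s * W j ω - compensator μ F W s j ω))) μ :=
    fun n => Integrable.of_bound ((hsm n).mono (hle n)).aestronglyMeasurable _ (hbd n)
  refine ⟨hint n, ?_⟩
  induction n with
  | zero => simp
  | succ n ih =>
    refine le_trans ?_ ih
    set Z := fun ω => Real.exp (∑ j ∈ Finset.range n, (s * W j ω - compensator μ F W s j ω))
      with hZ
    set g := compensator μ F W s n with hg
    set H := fun ω => Z ω * Real.exp (-g ω) with hH
    have mH : StronglyMeasurable[F n] H :=
      (hsm n).mul (Real.continuous_exp.comp_stronglyMeasurable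
        (stronglyMeasurable_compensator n).neg)
    have bH : ∀ᵐ ω ∂μ, |H ω| ≤ Real.exp (3 * n) * Real.exp 2 := by
      filter_upwards [hbd n, abs_compensator_le (μ := μ) (F := F) hb hWb hs hsb n] with ω h1 h2
      rw [hH, abs_mul]
      refine mul_le_mul h1 ?_ (abs_nonneg _) (Real.exp_pos _).le
      rw [abs_of_pos (Real.exp_pos _), Real.exp_le_exp]
      linarith [(abs_le.1 h2).1]
    have mW : AEStronglyMeasurable (W n) μ := ((hW n).mono (hle _)).aestronglyMeasurable
    have iW : Integrable (W n) μ := Integrable.of_bound mW b (ae_of_all _ (hWb n))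
    have iW2 : Integrable (fun ω => W n ω ^ 2) μ :=
      Integrable.of_bound (mW.pow 2) (b ^ 2) (ae_of_all _ fun ω => by
        rw [Real.norm_eq_abs, abs_pow]; exact pow_le_pow_left₀ (abs_nonneg _) (hWb n ω) 2)
    have mH' := (mH.mono (hle n)).aestronglyMeasurable (μ := μ)
    have iH : Integrable H μ := Integrable.of_bound mH' _ bH
    have iHW : Integrable (fun ω => H ω * W n ω) μ := iW.bdd_mul mH' bH
    have iHW2 : Integrable (fun ω => H ω * W n ω ^ 2) μ := iW2.bdd_mul mH' bH
    have iHc : Integrable (fun ω => H ω * (μ[W n|F n]) ω) μ := integrable_condExp.bdd_mul mH' bH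
    have iHc2 : Integrable (fun ω => H ω * (μ[fun ω => W n ω ^ 2|F n]) ω) μ :=
      integrable_condExp.bdd_mul mH' bH
    calc ∫ ω, Real.exp (∑ j ∈ Finset.range (n + 1), (s * W j ω - compensator μ F W s j ω)) ∂μ
        ≤ ∫ ω, (H ω + s * (H ω * W n ω) + s ^ 2 * (H ω * W n ω ^ 2)) ∂μ := by
          refine integral_mono (hint (n + 1))
            ((iH.add (iHW.const_mul s)).add (iHW2.const_mul (s ^ 2))) fun ω => ?_
          have h1 := (abs_le.1 (Real.abs_exp_sub_one_sub_id_le (hsW n ω))).2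
          have h2 : Real.exp (∑ j ∈ Finset.range (n + 1), (s * W j ω - compensator μ F W s j ω)) =
              H ω * Real.exp (s * W n ω) := by
            simp only [hH, hZ]
            rw [Finset.sum_range_succ, ← Real.exp_add, ← Real.exp_add]
            congr 1
            ring
          simp only
          rw [h2]
          have hH0 : 0 ≤ H ω := by positivity
          have h3 : Real.exp (s * W n ω) ≤ 1 + s * W n ω + (s * W n ω) ^ 2 := by linarith
          refine (mul_le_mul_of_nonneg_left h3 hH0).trans (le_of_eq ?_)
          ring
      _ = ∫ ω, (H ω + s * (H ω * (μ[W n|F n]) ω) +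
            s ^ 2 * (H ω * (μ[fun ω => W n ω ^ 2|F n]) ω)) ∂μ := by
          have j1 : Integrable (fun ω => H ω + s * (H ω * W n ω)) μ := iH.add (iHW.const_mul s)
          have j2 : Integrable (fun ω => H ω + s * (H ω * (μ[W n|F n]) ω)) μ :=
            iH.add (iHc.const_mul s)
          rw [integral_add j1 (iHW2.const_mul (s ^ 2)),
            integral_add iH (iHW.const_mul s), integral_const_mul, integral_const_mul,
            integral_add j2 (iHc2.const_mul (s ^ 2)),
            integral_add iH (iHc.const_mul s), integral_const_mul, integral_const_mul,
            integral_mul_condExp (hle n) mH bH iW, integral_mul_condExp (hle n) mH bH iW2]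
      _ ≤ ∫ ω, Z ω ∂μ := by
          refine integral_mono ((iH.add (iHc.const_mul s)).add (iHc2.const_mul (s ^ 2)))
            (hint n) fun ω => ?_
          simp only
          have h1 : H ω + s * (H ω * (μ[W n|F n]) ω) +
              s ^ 2 * (H ω * (μ[fun ω => W n ω ^ 2|F n]) ω) =
              Z ω * (Real.exp (-g ω) * (g ω + 1)) := by
            simp only [hH, hg, compensator]; ring
          rw [h1]
          have h2 : Real.exp (-g ω) * (g ω + 1) ≤ 1 := by
            rw [Real.exp_neg, inv_mul_le_iff₀ (Real.exp_pos _), mul_one]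
            exact Real.add_one_le_exp _
          exact mul_le_of_le_one_right (Real.exp_pos _).le h2

/-- A Bernstein-type inequality for sums of bounded variables, each weakly dependent on its
past. -/
theorem measureReal_sum_ge_le (hF : Monotone F) (hle : ∀ j, F j ≤ mΩ) (hG : ∀ j, G j ≤ mΩ)
    (hW : ∀ j, StronglyMeasurable[F (j + 1)] (W j)) (hWG : ∀ j, StronglyMeasurable[G j] (W j))
    {a v : ℝ} (hα : ∀ j, AlphaLE μ (F j) (G j) a)
    (hb : 0 ≤ b) (hWb : ∀ j ω, |W j ω| ≤ b) (hs : 0 ≤ s) (hsb : s * b ≤ 1)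
    (hmean : ∀ j, ∫ ω, W j ω ∂μ = 0) (hvar : ∀ j, ∫ ω, W j ω ^ 2 ∂μ ≤ v) (n : ℕ) (x : ℝ) :
    μ.real {ω | x ≤ ∑ j ∈ Finset.range n, W j ω} ≤
      8 * n * a + Real.exp (1 + s ^ 2 * (n * v) - s * x) := by
  obtain ⟨hZi, hZ⟩ := integral_exp_sum_sub_compensator_le (μ := μ) hF hle hW hb hWb hs hsb n
  set Z := fun ω => Real.exp (∑ j ∈ Finset.range n, (s * W j ω - compensator μ F W s j ω)) with hZd
  -- `D` measures how far the conditional first and second moments are from the unconditional ones.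
  -- Since s b ≤ 1, mixing bounds each of the two terms of a summand by 4a in mean, so E D ≤ 8na.
  set D := fun ω => ∑ j ∈ Finset.range n, (s * |(μ[W j|F j]) ω - ∫ ω', W j ω' ∂μ| +
    s ^ 2 * |(μ[fun ω => W j ω ^ 2|F j]) ω - ∫ ω', W j ω' ^ 2 ∂μ|) with hD
  have ha : 0 ≤ a := (abs_nonneg _).trans (hα 0 ∅ ∅ (@MeasurableSet.empty _ (F 0)) (@MeasurableSet.empty _ (G 0)))
  have i1 : ∀ j, Integrable (fun ω => s * |(μ[W j|F j]) ω - ∫ ω', W j ω' ∂μ|) μ := fun j =>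
    (integrable_condExp.sub (integrable_const _)).abs.const_mul s
  have i2 : ∀ j, Integrable
      (fun ω => s ^ 2 * |(μ[fun ω => W j ω ^ 2|F j]) ω - ∫ ω', W j ω' ^ 2 ∂μ|) μ := fun j =>
    (integrable_condExp.sub (integrable_const _)).abs.const_mul (s ^ 2)
  have i3 : ∀ j, Integrable (fun ω => s * |(μ[W j|F j]) ω - ∫ ω', W j ω' ∂μ| +
      s ^ 2 * |(μ[fun ω => W j ω ^ 2|F j]) ω - ∫ ω', W j ω' ^ 2 ∂μ|) μ :=
    fun j => (i1 j).add (i2 j)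
  have hDi : Integrable D μ := integrable_finsetSum _ fun j _ => i3 j
  have hDle : ∫ ω, D ω ∂μ ≤ 8 * n * a := by
    rw [hD, integral_finsetSum _ fun j _ => i3 j]
    calc _ ≤ ∑ j ∈ Finset.range n, 8 * a := Finset.sum_le_sum fun j _ => by
          rw [integral_add (i1 j) (i2 j), integral_const_mul, integral_const_mul]
          have h1 := (hα j).integral_abs_condExp_sub_le (hle j) (hG j) (hWG j) (hWb j)
          have h2 := (hα j).integral_abs_condExp_sub_le (hle j) (hG j) ((hWG j).pow 2)
            (M := b ^ 2) (fun ω => by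
              rw [Pi.pow_apply, abs_pow]; exact pow_le_pow_left₀ (abs_nonneg _) (hWb j ω) 2)
          have h3 := mul_le_mul_of_nonneg_left h1 hs
          have h4 := mul_le_mul_of_nonneg_left h2 (sq_nonneg s)
          have h5 : s * b * a ≤ a := mul_le_of_le_one_left ha hsb
          have h6 : (s * b) ^ 2 * a ≤ a :=
            mul_le_of_le_one_left ha (pow_le_one₀ (by positivity) hsb)
          have h7 : s * ∫ ω, |(μ[W j|F j]) ω - ∫ ω', W j ω' ∂μ| ∂μ ≤ 4 * a := by
            linarith
          have h8 : s ^ 2 * ∫ ω, |(μ[fun ω => W j ω ^ 2|F j]) ω - ∫ ω', W j ω' ^ 2 ∂μ| ∂μ ≤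
              4 * a := by
            refine h4.trans ?_
            linarith
          linarith
      _ = 8 * n * a := by simp; ring
  set y := Real.exp (s * x - 1 - s ^ 2 * (n * v)) with hy
  -- Where D < 1, the total compensator is below 1 + s²nv, so a large sum forces a large `Z`.
  -- Markov's inequality then handles both events; this is the source of the 1 in the exponent.
  have hsub : {ω | x ≤ ∑ j ∈ Finset.range n, W j ω} ⊆ {ω | 1 ≤ D ω} ∪ {ω | y ≤ Z ω} := by
    intro ω hω
    by_cases h1 : 1 ≤ D ω
    · exact Or.inl h1
    · refine Or.inr ?_
      have h1' := not_le.1 h1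
      simp only [Set.mem_ofPred_eq, hy, hZd] at hω ⊢
      rw [Real.exp_le_exp, Finset.sum_sub_distrib, ← Finset.mul_sum]
      have h2 := mul_le_mul_of_nonneg_left hω hs
      have h3 : ∑ j ∈ Finset.range n, compensator μ F W s j ω ≤ D ω + s ^ 2 * (n * v) := by
        have e : s ^ 2 * (n * v) = ∑ j ∈ Finset.range n, s ^ 2 * v := by simp; ring
        rw [e, hD, ← Finset.sum_add_distrib]
        refine Finset.sum_le_sum fun j _ => ?_
        unfold compensator
        have h4 := mul_le_mul_of_nonneg_left (le_abs_self ((μ[W j|F j]) ω - ∫ ω', W j ω' ∂μ)) hs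
        rw [hmean j] at h4 ⊢
        have h5 := mul_le_mul_of_nonneg_left (le_abs_self
          ((μ[fun ω => W j ω ^ 2|F j]) ω - ∫ ω', W j ω' ^ 2 ∂μ)) (sq_nonneg s)
        have h6 := mul_le_mul_of_nonneg_left (hvar j) (sq_nonneg s)
        linarith
      linarith
  have hM1 := mul_meas_ge_le_integral_of_nonneg (ae_of_all μ fun ω => by
    simp only [hD, Pi.zero_apply]; positivity) hDi 1
  have hM2 := mul_meas_ge_le_integral_of_nonneg (ae_of_all μ fun ω => (Real.exp_pos _).le) hZi y
  have hy0 : 0 < y := Real.exp_pos _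
  have hM3 : μ.real {ω | y ≤ Z ω} ≤ Real.exp (1 + s ^ 2 * (n * v) - s * x) := by
    have e : Real.exp (1 + s ^ 2 * (n * v) - s * x) = y⁻¹ := by
      rw [hy, ← Real.exp_neg]; congr 1; ring
    rw [e, ← one_div, le_div_iff₀ hy0, mul_comm]
    exact hM2.trans hZ
  calc _ ≤ μ.real ({ω | 1 ≤ D ω} ∪ {ω | y ≤ Z ω}) := measureReal_mono hsub
    _ ≤ _ := measureReal_union_le _ _
    _ ≤ _ := by linarith

/-- Even and odd blocks of length `q`: two blocks of the same parity are separated by a gap of `q`.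
The redundant `0 +` gives both sums the shape of a general offset. -/
theorem sum_range_two_mul_mul (q m : ℕ) (y : ℕ → ℝ) :
    ∑ i ∈ Finset.range (2 * q * m), y i =
      ∑ j ∈ Finset.range m, ∑ i ∈ Finset.range q, y (0 + 2 * q * j + i) +
      ∑ j ∈ Finset.range m, ∑ i ∈ Finset.range q, y (q + 2 * q * j + i) := by
  induction m with
  | zero => simp
  | succ m ih =>
    have e : 2 * q * (m + 1) = 2 * q * m + q + q := by ring
    rw [e, Finset.sum_range_add, Finset.sum_range_add, ih, Finset.sum_range_succ,
      Finset.sum_range_succ]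
    have : ∀ i, 2 * q * m + q + i = q + 2 * q * m + i := fun i => by ring
    simp only [this, zero_add]
    ring

/-- Blocking: a two-sided exponential inequality for a bounded, centred sequence whose entries
after time `i` are weakly dependent on its entries before time `i - q`. -/
theorem measureReal_abs_sum_ge_le {ℱ 𝒢 : ℕ → MeasurableSpace Ω} (hℱ : Monotone ℱ)
    (h𝒢 : Antitone 𝒢) (hle : ∀ i, ℱ i ≤ mΩ) (hle' : ∀ i, 𝒢 i ≤ mΩ) {y : ℕ → Ω → ℝ} {q : ℕ}
    (hyℱ : ∀ i, StronglyMeasurable[ℱ (i + q + 1)] (y i))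
    (hy𝒢 : ∀ i, StronglyMeasurable[𝒢 i] (y i)) {a β w : ℝ}
    (hα : ∀ i, AlphaLE μ (ℱ i) (𝒢 i) a) (hβ0 : 0 ≤ β) (hβ : ∀ i ω, |y i ω| ≤ β)
    (hmean : ∀ i, ∫ ω, y i ω ∂μ = 0)
    (hw : ∀ o, ∫ ω, (∑ i ∈ Finset.range q, y (o + i) ω) ^ 2 ∂μ ≤ w) (hs : 0 ≤ s)
    (hsb : s * (q * β) ≤ 1) (m : ℕ) (x : ℝ) :
    μ.real {ω | 2 * x ≤ |∑ i ∈ Finset.range (2 * q * m), y i ω|} ≤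
      4 * (8 * m * a + Real.exp (1 + s ^ 2 * (m * w) - s * x)) := by
  have hyi : ∀ i, Integrable (y i) μ := fun i =>
    Integrable.of_bound ((hy𝒢 i).mono (hle' i)).aestronglyMeasurable β (ae_of_all _ (hβ i))
  -- The offset `o` selects the parity and the sign c = ±1 selects the tail, so one estimate serves
  -- four times.
  have key : ∀ (o : ℕ) (c : ℝ), c ^ 2 = 1 → μ.real {ω | x ≤ ∑ j ∈ Finset.range m,
      c * ∑ i ∈ Finset.range q, y (o + 2 * q * j + i) ω} ≤
      8 * m * a + Real.exp (1 + s ^ 2 * (m * w) - s * x) := by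
    intro o c hc
    have hc1 : |c| = 1 := by
      rw [← sq_abs] at hc
      exact (pow_eq_one_iff_of_nonneg (abs_nonneg c) two_ne_zero).1 hc
    refine measureReal_sum_ge_le (F := fun j => ℱ (o + 2 * q * j))
      (G := fun j => 𝒢 (o + 2 * q * j)) (b := q * β)
      (W := fun j ω => c * ∑ i ∈ Finset.range q, y (o + 2 * q * j + i) ω)
      (fun i j hij => hℱ (by gcongr)) (fun j => hle _)
      (fun j => hle' _) (fun j => ?_) (fun j => ?_) (fun j => hα _) (by positivity) (fun j ω => ?_)
      hs hsb (fun j => ?_) (fun j => ?_) m x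
    -- The last index of block `j` is o + 2qj + q - 1, so the block is measurable for `ℱ` at o +
    -- 2q(j + 1), exactly the σ-algebra attached to the next block.
    · refine (Finset.stronglyMeasurable_fun_sum _ fun i hi => ?_).const_mul c
      refine (hyℱ _).mono (hℱ ?_)
      have := Finset.mem_range.1 hi
      rw [mul_add]
      omega
    · refine (Finset.stronglyMeasurable_fun_sum _ fun i hi => ?_).const_mul c
      exact (hy𝒢 _).mono (h𝒢 (Nat.le_add_right _ _))
    · rw [abs_mul, hc1, one_mul]
      refine (Finset.abs_sum_le_sum_abs _ _).trans ?_
      refine (Finset.sum_le_sum fun i _ => hβ _ ω).trans ?_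
      simp
    · rw [integral_const_mul, integral_finsetSum _ fun i _ => hyi _]
      simp [hmean]
    · simp only [mul_pow, hc, one_mul]
      exact hw _
  have hsub : {ω | 2 * x ≤ |∑ i ∈ Finset.range (2 * q * m), y i ω|} ⊆
      (({ω | x ≤ ∑ j ∈ Finset.range m, 1 * ∑ i ∈ Finset.range q, y (0 + 2 * q * j + i) ω} ∪
        {ω | x ≤ ∑ j ∈ Finset.range m, 1 * ∑ i ∈ Finset.range q, y (q + 2 * q * j + i) ω}) ∪
      {ω | x ≤ ∑ j ∈ Finset.range m, (-1) * ∑ i ∈ Finset.range q, y (0 + 2 * q * j + i) ω}) ∪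
        {ω | x ≤ ∑ j ∈ Finset.range m, (-1) * ∑ i ∈ Finset.range q, y (q + 2 * q * j + i) ω} := by
    intro ω hω
    simp only [Set.mem_ofPred_eq, Set.mem_union] at hω ⊢
    rw [sum_range_two_mul_mul q m (fun i => y i ω)] at hω
    simp only [← Finset.mul_sum]
    by_contra hcon
    push Not at hcon
    obtain ⟨⟨⟨h1, h2⟩, h3⟩, h4⟩ := hcon
    rcases le_abs.1 hω with h | h <;> linarith
  refine (measureReal_mono hsub).trans ?_
  refine (measureReal_union_le _ _).trans ?_
  have h12 := (measureReal_union_le (μ := μ) _ _).trans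
    (add_le_add (key 0 1 (by norm_num)) (key q 1 (by norm_num)))
  have h123 := (measureReal_union_le (μ := μ) _ _).trans
    (add_le_add h12 (key 0 (-1) (by norm_num)))
  have := add_le_add h123 (key q (-1) (by norm_num))
  linarith

end Exponential

/-! ### Second moments under geometrically decaying correlations. -/

section Variance

/-- The subtraction is truncated: lags below `k` contribute 1 each, and the remaining ones form a
geometric series. -/
theorem sum_pow_tsub_le {δ : ℝ} (hδ : 0 < δ) (hδ1 : δ < 1) (n k : ℕ) :
    ∑ h ∈ Finset.range n, δ ^ (h - k) ≤ k + (1 - δ)⁻¹ := by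
  calc ∑ h ∈ Finset.range n, δ ^ (h - k) ≤ ∑ h ∈ Finset.range (k + n), δ ^ (h - k) :=
        Finset.sum_le_sum_of_subset_of_nonneg (Finset.range_mono (by omega))
          fun _ _ _ => by positivity
    _ = ∑ h ∈ Finset.range k, δ ^ (h - k) + ∑ h ∈ Finset.range n, δ ^ h := by
        rw [Finset.sum_range_add]; simp
    _ ≤ _ := by
        gcongr
        · calc _ ≤ ∑ h ∈ Finset.range k, (1 : ℝ) :=
                Finset.sum_le_sum fun h _ => pow_le_one₀ hδ.le hδ1.le
            _ = k := by simp
        · rw [← tsum_geometric_of_lt_one hδ.le hδ1]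
          exact (summable_geometric_of_lt_one hδ.le hδ1).sum_le_tsum _ fun _ _ => by positivity

/-- In truncated subtraction (j - i) + (i - j) is the distance |j - i|; the indices on either side
of `i` give one one-sided sum each. -/
theorem sum_pow_dist_tsub_le {δ : ℝ} (hδ : 0 < δ) (hδ1 : δ < 1) {q k i : ℕ} (hi : i < q) :
    ∑ j ∈ Finset.range q, δ ^ ((j - i) + (i - j) - k) ≤ 2 * (k + (1 - δ)⁻¹) := by
  rw [← Finset.sum_range_add_sum_Ico _ hi.le, Finset.sum_Ico_eq_sum_range, two_mul]
  refine add_le_add ?_ ?_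
  · rw [← Finset.sum_range_reflect]
    refine le_trans (Finset.sum_le_sum fun j hj => ?_) (sum_pow_tsub_le hδ hδ1 i k)
    have := Finset.mem_range.1 hj
    exact pow_le_pow_of_le_one hδ.le hδ1.le (by omega)
  · refine le_trans (Finset.sum_le_sum fun j hj => ?_) (sum_pow_tsub_le hδ hδ1 (q - i) k)
    exact pow_le_pow_of_le_one hδ.le hδ1.le (by omega)

variable {Ω : Type*} {mΩ : MeasurableSpace Ω} {μ : Measure Ω}

/-- Second moment of a sum with geometrically decaying correlations beyond lag `k`. -/
theorem integral_sq_sum_le {y : ℕ → Ω → ℝ} {C δ : ℝ} (hδ : 0 < δ) (hδ1 : δ < 1)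
    (hC : 0 ≤ C) {q k : ℕ} (hint : ∀ i j, Integrable (fun ω => y i ω * y j ω) μ)
    (hcov : ∀ i j, i ≤ j → |∫ ω, y i ω * y j ω ∂μ| ≤ C * δ ^ (j - i - k)) :
    ∫ ω, (∑ i ∈ Finset.range q, y i ω) ^ 2 ∂μ ≤ 2 * C * q * (k + (1 - δ)⁻¹) := by
  have hcov' : ∀ i j, ∫ ω, y i ω * y j ω ∂μ ≤ C * δ ^ ((j - i) + (i - j) - k) := by
    intro i j
    rcases le_total i j with h | h
    · refine (le_abs_self _).trans ((hcov i j h).trans (le_of_eq ?_))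
      congr 2; omega
    · refine (le_abs_self _).trans ?_
      simp only [mul_comm (y i _)]
      refine (hcov j i h).trans (le_of_eq ?_)
      congr 2; omega
  simp only [sq, Finset.sum_mul_sum]
  rw [integral_finsetSum _ fun i _ => integrable_finsetSum _ fun j _ => hint i j]
  calc _ ≤ ∑ i ∈ Finset.range q, C * (2 * (k + (1 - δ)⁻¹)) := by
        refine Finset.sum_le_sum fun i hi => ?_
        rw [integral_finsetSum _ fun j _ => hint i j]
        refine (Finset.sum_le_sum fun j _ => hcov' i j).trans ?_
        rw [← Finset.mul_sum]
        exact mul_le_mul_of_nonneg_left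
          (sum_pow_dist_tsub_le hδ hδ1 (Finset.mem_range.1 hi)) hC
    _ = _ := by simp; ring

end Variance

/-! ### Deviations of sums of truncated products. -/

section Truncated

variable {Ω : Type*} {mΩ : MeasurableSpace Ω} {μ : Measure Ω} {X : ℤ → ℕ → Ω → ℝ} {T : ℕ}

theorem sigmaPast_mono {s t : ℤ} (h : s ≤ t) : sigmaPast X T s ≤ sigmaPast X T t :=
  iSup_le fun u => le_iSup (fun s : {s : ℤ // s ≤ t} =>
    MeasurableSpace.comap (X s T) inferInstance) ⟨u, u.2.trans h⟩

theorem sigmaFuture_anti {s t : ℤ} (h : s ≤ t) : sigmaFuture X T t ≤ sigmaFuture X T s :=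
  iSup_le fun u => le_iSup (fun u : {u : ℤ // s ≤ u} =>
    MeasurableSpace.comap (X u T) inferInstance) ⟨u, h.trans u.2⟩

theorem sigmaPast_le (hX : ∀ t, Measurable (X t T)) (t : ℤ) : sigmaPast X T t ≤ mΩ :=
  iSup_le fun u => (hX u).comap_le

theorem sigmaFuture_le (hX : ∀ t, Measurable (X t T)) (t : ℤ) : sigmaFuture X T t ≤ mΩ :=
  iSup_le fun u => (hX u).comap_le

theorem measurable_sigmaPast {s t : ℤ} (h : s ≤ t) : Measurable[sigmaPast X T t] (X s T) :=
  (comap_measurable (X s T)).mono (le_iSup (fun s : {s : ℤ // s ≤ t} =>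
    MeasurableSpace.comap (X s T) inferInstance) ⟨s, h⟩) le_rfl

theorem measurable_sigmaFuture {s t : ℤ} (h : t ≤ s) : Measurable[sigmaFuture X T t] (X s T) :=
  (comap_measurable (X s T)).mono (le_iSup (fun s : {s : ℤ // t ≤ s} =>
    MeasurableSpace.comap (X s T) inferInstance) ⟨s, h⟩) le_rfl

/-- The product `X_{l-k} X_l` with both factors truncated at level `B`. -/
def truncProd (X : ℤ → ℕ → Ω → ℝ) (T : ℕ) (B : ℝ) (k : ℕ) (l : ℤ) (ω : Ω) : ℝ :=
  clamp B (X (l - k) T ω) * clamp B (X l T ω)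

theorem stronglyMeasurable_truncProd_past (B : ℝ) (k : ℕ) (l : ℤ) :
    StronglyMeasurable[sigmaPast X T l] (truncProd X T B k l) := by
  have h1 : Measurable[sigmaPast X T l] (fun ω => clamp B (X (l - k) T ω)) :=
    (measurable_clamp B).comp (measurable_sigmaPast (by omega))
  have h2 : Measurable[sigmaPast X T l] (fun ω => clamp B (X l T ω)) :=
    (measurable_clamp B).comp (measurable_sigmaPast le_rfl)
  exact h1.stronglyMeasurable.mul h2.stronglyMeasurable

theorem stronglyMeasurable_truncProd_future (B : ℝ) (k : ℕ) (l : ℤ) :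
    StronglyMeasurable[sigmaFuture X T (l - k)] (truncProd X T B k l) := by
  have h1 : Measurable[sigmaFuture X T (l - k)] (fun ω => clamp B (X (l - k) T ω)) :=
    (measurable_clamp B).comp (measurable_sigmaFuture le_rfl)
  have h2 : Measurable[sigmaFuture X T (l - k)] (fun ω => clamp B (X l T ω)) :=
    (measurable_clamp B).comp (measurable_sigmaFuture (by omega))
  exact h1.stronglyMeasurable.mul h2.stronglyMeasurable

theorem abs_truncProd_le {B : ℝ} (hB : 0 ≤ B) (k : ℕ) (l : ℤ) (ω : Ω) :
    |truncProd X T B k l ω| ≤ B ^ 2 := by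
  unfold truncProd
  rw [abs_mul, sq]
  exact mul_le_mul (abs_clamp_le hB _) (abs_clamp_le hB _) (abs_nonneg _) hB

/-- This makes the fourth moments of the truncated products bounded independently of the level `B`,
so block variances do not grow with the truncation. -/
theorem truncProd_pow_four_le {B : ℝ} (hB : 0 ≤ B) (k : ℕ) (l : ℤ) (ω : Ω) :
    truncProd X T B k l ω ^ 4 ≤ (X (l - k) T ω ^ 8 + X l T ω ^ 8) / 2 := by
  have h : truncProd X T B k l ω ^ 4 ≤ (X (l - k) T ω * X l T ω) ^ 4 := by
    rw [← Even.pow_abs (by decide : Even 4), ← Even.pow_abs (by decide : Even 4) (_ * _)]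
    refine pow_le_pow_left₀ (abs_nonneg _) ?_ 4
    unfold truncProd
    rw [abs_mul, abs_mul]
    exact mul_le_mul (abs_clamp_le_abs hB _) (abs_clamp_le_abs hB _) (abs_nonneg _) (abs_nonneg _)
  refine h.trans ?_
  nlinarith [sq_nonneg (X (l - k) T ω ^ 4 - X l T ω ^ 4)]

theorem integral_sub_mul_sub [IsProbabilityMeasure μ] {U V : Ω → ℝ} (hU : Integrable U μ)
    (hV : Integrable V μ) (hUV : Integrable (fun ω => U ω * V ω) μ) :
    ∫ ω, (U ω - ∫ ω', U ω' ∂μ) * (V ω - ∫ ω', V ω' ∂μ) ∂μ =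
      ∫ ω, U ω * V ω ∂μ - (∫ ω, U ω ∂μ) * ∫ ω, V ω ∂μ := by
  set u := ∫ ω, U ω ∂μ with hu
  set v := ∫ ω, V ω ∂μ with hv
  have e : ∀ ω, (U ω - u) * (V ω - v) = U ω * V ω - (v * U ω + u * V ω - u * v) := fun ω => by ring
  simp only [e]
  have i1 : Integrable (fun ω => v * U ω + u * V ω) μ := (hU.const_mul v).add (hV.const_mul u)
  have i2 : Integrable (fun ω => v * U ω + u * V ω - u * v) μ := i1.sub (integrable_const _)
  rw [integral_sub hUV i2, integral_sub i1 (integrable_const _),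
    integral_add (hU.const_mul v) (hV.const_mul u), integral_const_mul, integral_const_mul]
  simp only [integral_const, probReal_univ, smul_eq_mul, one_mul, ← hu, ← hv]
  ring

/-- Exponential inequality for the sums of truncated products along a window of length `n₀`. -/
theorem measureReal_abs_sum_truncProd_ge_le [IsProbabilityMeasure μ]
    (hX : ∀ t, Measurable (X t T)) {K δ κ : ℝ} (hK : 1 ≤ K) (hδ : 0 < δ) (hδ1 : δ < 1)
    (hα : ∀ (t : ℤ) (n : ℕ), AlphaLE μ (sigmaPast X T t) (sigmaFuture X T (t + n))
      (K * (δ ^ n) ^ 3))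
    (hκ : ∀ s : ℤ, 1 ≤ s → s ≤ T →
      Integrable (fun ω => X s T ω ^ 8) μ ∧ ∫ ω, X s T ω ^ 8 ∂μ ≤ κ)
    {B : ℝ} (hB : 0 ≤ B) {k q n₀ m : ℕ} (hkq : k ≤ q) (hm : n₀ ≤ 2 * q * m) {s₀ : ℤ}
    (hs₀ : 1 ≤ s₀ - k) (hn₀ : s₀ + n₀ ≤ T + 1) {s : ℝ} (hs : 0 ≤ s)
    (hsb : s * (q * (2 * B ^ 2)) ≤ 1) (x : ℝ) :
    μ.real {ω | 2 * x ≤ |∑ i ∈ Finset.range n₀,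
      (truncProd X T B k (s₀ + i) ω - ∫ ω', truncProd X T B k (s₀ + i) ω' ∂μ)|} ≤
      4 * (8 * m * (K * (δ ^ (q + 1 - k)) ^ 3) +
        Real.exp (1 + s ^ 2 * (m * (2 * (4 * K + 4 * (1 + κ) ^ 2) * q * (k + (1 - δ)⁻¹)))
          - s * x)) := by
  set U := fun i : ℕ => truncProd X T B k (s₀ + i) with hUdef
  -- Padding by zeros fills the window up to whole blocks and avoids times outside 1, …, T, where no
  -- moments are controlled.
  set y : ℕ → Ω → ℝ := fun i ω => if i < n₀ then U i ω - ∫ ω', U i ω' ∂μ else 0 with hy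
  have mUp : ∀ i : ℕ, StronglyMeasurable[sigmaPast X T (s₀ + i)] (U i) :=
    fun i => stronglyMeasurable_truncProd_past B k _
  have mUf : ∀ i : ℕ, StronglyMeasurable[sigmaFuture X T (s₀ + i - k)] (U i) :=
    fun i => stronglyMeasurable_truncProd_future B k _
  have mU : ∀ i, StronglyMeasurable (U i) := fun i => (mUp i).mono (sigmaPast_le hX _)
  have bU : ∀ i ω, |U i ω| ≤ B ^ 2 := fun i ω => abs_truncProd_le hB k _ ω
  have iU : ∀ i, Integrable (U i) μ := fun i =>
    Integrable.of_bound (mU i).aestronglyMeasurable _ (ae_of_all _ (bU i))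
  have iUU : ∀ i j, Integrable (fun ω => U i ω * U j ω) μ := fun i j =>
    (iU j).bdd_mul (mU i).aestronglyMeasurable (ae_of_all _ (bU i))
  have ybd : ∀ i ω, |y i ω| ≤ 2 * B ^ 2 := by
    intro i ω
    simp only [hy]
    split_ifs
    · have h1 := bU i ω
      have h2 : |∫ ω', U i ω' ∂μ| ≤ B ^ 2 := by
        have := norm_integral_le_of_norm_le_const (μ := μ) (f := U i) (C := B ^ 2)
          (ae_of_all _ (bU i))
        simpa using this
      exact (abs_sub _ _).trans (by linarith)
    · simp; positivity
  have ymeas : ∀ (m : MeasurableSpace Ω) i, StronglyMeasurable[m] (U i) →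
      StronglyMeasurable[m] (y i) := by
    intro m i h
    simp only [hy]
    split_ifs
    · exact h.sub stronglyMeasurable_const
    · exact stronglyMeasurable_const
  have my : ∀ i, StronglyMeasurable (y i) := fun i => ymeas _ i (mU i)
  have iy : ∀ i, Integrable (y i) μ := fun i =>
    Integrable.of_bound (my i).aestronglyMeasurable _ (ae_of_all _ (ybd i))
  have iyy : ∀ i j, Integrable (fun ω => y i ω * y j ω) μ := fun i j =>
    (iy j).bdd_mul (my i).aestronglyMeasurable (ae_of_all _ (ybd i))
  have U4 : ∀ i < n₀, Integrable (fun ω => U i ω ^ 4) μ ∧ ∫ ω, U i ω ^ 4 ∂μ ≤ κ := by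
    intro i hi
    obtain ⟨h1, h2⟩ := hκ (s₀ + i - k) (by omega) (by omega)
    obtain ⟨h3, h4⟩ := hκ (s₀ + i) (by omega) (by omega)
    have hi4 : Integrable (fun ω => (X (s₀ + i - k) T ω ^ 8 + X (s₀ + i) T ω ^ 8) / 2) μ :=
      (h1.add h3).div_const 2
    have hUi : Integrable (fun ω => U i ω ^ 4) μ :=
      hi4.mono' ((mU i).aestronglyMeasurable.pow 4) (ae_of_all _ fun ω => by
        rw [Real.norm_eq_abs, abs_of_nonneg (by positivity)]
        exact truncProd_pow_four_le hB k _ ω)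
    refine ⟨hUi, (integral_mono hUi hi4 fun ω => truncProd_pow_four_le hB k _ ω).trans ?_⟩
    rw [integral_div, integral_add h1 h3]
    linarith
  have hC : 0 ≤ 4 * K + 4 * (1 + κ) ^ 2 := by positivity
  have hcov : ∀ i j, i ≤ j →
      |∫ ω, y i ω * y j ω ∂μ| ≤ (4 * K + 4 * (1 + κ) ^ 2) * δ ^ (j - i - k) := by
    intro i j hij
    have hpos : 0 ≤ (4 * K + 4 * (1 + κ) ^ 2) * δ ^ (j - i - k) := by positivity
    by_cases hj : j < n₀
    · have hi : i < n₀ := hij.trans_lt hj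
      simp only [hy, hi, hj, if_true]
      rw [integral_sub_mul_sub (iU i) (iU j) (iUU i j)]
      obtain ⟨u1, u2⟩ := U4 i hi
      obtain ⟨v1, v2⟩ := U4 j hj
      refine AlphaLE.abs_integral_mul_sub_le_of_pow_four (sigmaPast_le hX (s₀ + i))
        (sigmaFuture_le hX (s₀ + j - k)) (by positivity) ?_ (mUp i) (mUf j) u1 v1 u2 v2
      -- Once the lag reaches `k`, the two products use disjoint ranges of time and mixing applies.
      -- At smaller lags they overlap, and the trivial coefficient 1 ≤ K corresponds to the exponent
      -- j - i - k = 0.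
      rcases le_or_gt k (j - i) with h | h
      · have e : s₀ + (j : ℤ) - k = s₀ + i + ((j - i - k : ℕ) : ℤ) := by omega
        rw [e]
        exact hα _ _
      · have e : j - i - k = 0 := by omega
        rw [e]
        exact alphaLE_one.mono le_rfl le_rfl (by simpa using hK)
    · simp only [hy, hj, if_false, mul_zero, integral_zero, abs_zero]
      exact hpos
  have key := measureReal_abs_sum_ge_le (μ := μ)
    -- The product at s₀ + i reaches back to s₀ + i - k, which leaves a gap of q + 1 - k between
    -- this past and that future.
    (ℱ := fun i => sigmaPast X T (s₀ + i - q - 1))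
    (𝒢 := fun i => sigmaFuture X T (s₀ + i - k)) (y := y) (q := q)
    (fun i j hij => sigmaPast_mono (by omega)) (fun i j hij => sigmaFuture_anti (by omega))
    (fun i => sigmaPast_le hX _) (fun i => sigmaFuture_le hX _)
    (fun i => ymeas _ i ((mUp i).mono (sigmaPast_mono (by push_cast; omega))))
    (fun i => ymeas _ i (mUf i)) (a := K * (δ ^ (q + 1 - k)) ^ 3)
    (fun i => by
      have e : s₀ + (i : ℤ) - k = s₀ + i - q - 1 + ((q + 1 - k : ℕ) : ℤ) := by omega
      rw [e]
      exact hα _ _)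
    (by positivity) ybd
    (fun i => by
      simp only [hy]
      split_ifs
      · rw [integral_sub (iU i) (integrable_const _)]; simp
      · simp)
    (fun o => integral_sq_sum_le (y := fun i => y (o + i)) hδ hδ1 hC (k := k)
      (fun i j => iyy _ _) fun i j hij => by
        refine (hcov (o + i) (o + j) (by omega)).trans (le_of_eq ?_)
        congr 2; omega)
    hs hsb m x
  refine le_trans (le_of_eq ?_) key
  congr 1
  ext ω
  simp only [Set.mem_ofPred_eq]
  have e : ∑ i ∈ Finset.range (2 * q * m), y i ω =
      ∑ i ∈ Finset.range n₀, (U i ω - ∫ ω', U i ω' ∂μ) := by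
    rw [← Finset.sum_subset (Finset.range_mono hm)]
    · exact Finset.sum_congr rfl fun i hi => by simp [hy, Finset.mem_range.1 hi]
    · intro i _ hi
      rw [Finset.mem_range] at hi
      simp [hy, hi]
  rw [e]

end Truncated

/-! ### Quantitative bounds extracted from the assumptions. -/

section Extraction

variable {Ω : Type*} {m₁ m₂ mΩ : MeasurableSpace Ω} {μ : Measure Ω} {X : ℤ → ℕ → Ω → ℝ}

/-- A real `sSup` dominates the members of its set only if the set is bounded above; here the bound
is 1. -/
theorem alphaLE_alphaCoeff [IsProbabilityMeasure μ] :
    AlphaLE μ m₁ m₂ (alphaCoeff μ m₁ m₂) := by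
  intro A B hA hB
  refine le_csSup ⟨1, ?_⟩ ⟨A, B, hA, hB, rfl⟩
  rintro r ⟨A, B, -, -, rfl⟩
  exact abs_measureReal_inter_sub_le_one A B

theorem alphaCoeff_le_one [IsProbabilityMeasure μ] :
    alphaCoeff μ m₁ m₂ ≤ 1 := by
  refine Real.sSup_le ?_ zero_le_one
  rintro r ⟨A, B, -, -, rfl⟩
  exact abs_measureReal_inter_sub_le_one A B

theorem alphaCoeff_le_mixingCoeff [IsProbabilityMeasure μ] {T : ℕ} (hT : 1 ≤ T) (t : ℤ) (n : ℕ) :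
    alphaCoeff μ (sigmaPast X T t) (sigmaFuture X T (t + n)) ≤ mixingCoeff μ X n := by
  refine le_csSup ⟨1, ?_⟩ ⟨T, t, hT, rfl⟩
  rintro r ⟨T, t, -, rfl⟩
  exact alphaCoeff_le_one

/-- With δ = ρ^{-1/3} the rate takes the cubed form of the covariance inequality. Enlarging `K` to
at least 1 lets the same constant absorb the trivial bound on the coefficient. -/
theorem IsGeometricallyMixing.exists_alphaLE [IsProbabilityMeasure μ]
    (h : IsGeometricallyMixing μ X) : ∃ K δ : ℝ, 1 ≤ K ∧ 0 < δ ∧ δ < 1 ∧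
      ∀ T : ℕ, 1 ≤ T → ∀ (t : ℤ) (n : ℕ),
        AlphaLE μ (sigmaPast X T t) (sigmaFuture X T (t + n)) (K * (δ ^ n) ^ 3) := by
  obtain ⟨K, ρ, hK, hρ, h⟩ := h
  have hρ0 : 0 < ρ⁻¹ := by positivity
  have hδ3 : (ρ⁻¹ ^ ((1 : ℝ) / 3)) ^ 3 = ρ⁻¹ := by
    rw [← Real.rpow_natCast, ← Real.rpow_mul hρ0.le]; norm_num
  refine ⟨max K 1, ρ⁻¹ ^ ((1 : ℝ) / 3), le_max_right _ _, Real.rpow_pos_of_pos hρ0 _,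
    Real.rpow_lt_one hρ0.le (inv_lt_one_of_one_lt₀ hρ) (by norm_num), fun T hT t n => ?_⟩
  refine alphaLE_alphaCoeff.mono le_rfl le_rfl ?_
  refine (alphaCoeff_le_mixingCoeff hT t n).trans ((h n).trans ?_)
  rw [← pow_mul, mul_comm n 3, pow_mul, hδ3, inv_pow]
  exact mul_le_mul_of_nonneg_right (le_max_left _ _) (by positivity)

theorem norm_localCov_le {f : ℝ → ℝ → ℝ} {M : ℝ} (hM : ∀ u θ, |f u θ| ≤ M) (k : ℤ) (u : ℝ) :
    ‖localCov f k u‖ ≤ 2 * Real.pi * M := by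
  have h := intervalIntegral.norm_integral_le_of_norm_le_const
    (f := fun θ : ℝ => Complex.exp (Complex.I * (k : ℂ) * (θ : ℂ)) * (f u θ : ℂ))
    (a := -Real.pi) (b := Real.pi) (C := M) (fun θ _ => by
      have e : Complex.I * (k : ℂ) * (θ : ℂ) = ((k * θ : ℝ) : ℂ) * Complex.I := by
        push_cast; ring
      rw [norm_mul, e, Complex.norm_exp_ofReal_mul_I, one_mul, Complex.norm_real]
      exact hM u θ)
  refine h.trans (le_of_eq ?_)
  rw [abs_of_nonneg (by linarith [Real.pi_pos])]
  ring

/-- The variances of a locally stationary array with bounded spectral density are bounded. -/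
theorem IsLocallyStationary.exists_variance_le {f : ℝ → ℝ → ℝ} (h : IsLocallyStationary μ X f)
    (hf : IsSpectrallyBounded f) :
    ∃ S : ℝ, 0 ≤ S ∧ ∀ T : ℕ, 1 ≤ T → ∀ t : ℤ, Var[X t T; μ] ≤ S := by
  obtain ⟨C, hC, hcov⟩ := h.cov_approx
  obtain ⟨m₀, M, hm₀, hM⟩ := hf
  have hM0 : 0 ≤ M := (abs_nonneg _).trans (hM 0 0).2
  refine ⟨C + 2 * Real.pi * M, by positivity, fun T hT t => ?_⟩
  have h1 := hcov T hT t 0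
  rw [sub_zero, covariance_self (h.measurable t T hT).aemeasurable] at h1
  have h2 := norm_localCov_le (fun u θ => (hM u θ).2) 0 ((t : ℝ) / T)
  have h3 : C / T ≤ C := div_le_self hC (by exact_mod_cast hT)
  have h4 : ‖((Var[X t T; μ] : ℝ) : ℂ)‖ ≤ C + 2 * Real.pi * M := by
    calc _ = ‖(((Var[X t T; μ] : ℝ) : ℂ) - localCov f 0 ((t : ℝ) / T)) +
          localCov f 0 ((t : ℝ) / T)‖ := by rw [sub_add_cancel]
      _ ≤ _ := norm_add_le _ _
      _ ≤ _ := by linarith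
  rw [Complex.norm_real] at h4
  exact (le_abs_self _).trans h4

/-- Uses n! ≤ nⁿ and inserts e⁻ⁿ eⁿ: at the level B = e c n^d, Markov's inequality of order `n`
leaves a tail of order e⁻ⁿ. -/
theorem BernsteinCondition.exists_moment_le {d S : ℝ} (h : BernsteinCondition μ X d)
    (hS : ∀ T : ℕ, 1 ≤ T → ∀ t : ℤ, Var[X t T; μ] ≤ S) :
    ∃ c : ℝ, 0 < c ∧ ∀ (T : ℕ) (t : ℤ), 1 ≤ t → t ≤ (T : ℤ) → ∀ n : ℕ, 2 ≤ n →
      Integrable (fun ω => |X t T ω| ^ n) μ ∧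
      ∫ ω, |X t T ω| ^ n ∂μ ≤
        S / c ^ 2 * Real.exp (-n) * (Real.exp 1 * c * (n : ℝ) ^ d) ^ n := by
  obtain ⟨hd, c, hc, h⟩ := h
  refine ⟨c, hc, fun T t h1 h2 n hn => ?_⟩
  obtain ⟨hi, hle⟩ := h T t h1 h2 n hn
  refine ⟨hi, hle.trans ?_⟩
  have hT : 1 ≤ T := by omega
  have e1 : S / c ^ 2 * Real.exp (-n) * (Real.exp 1 * c * (n : ℝ) ^ d) ^ n =
      c ^ (n - 2) * ((n : ℝ) ^ n) ^ d * S := by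
    have e2 : c ^ n = c ^ (n - 2) * c ^ 2 := by rw [← pow_add]; congr 1; omega
    have e3 : Real.exp (-n) * Real.exp 1 ^ n = 1 := by
      rw [← Real.exp_nat_mul, ← Real.exp_add]; simp
    have e4 : ((n : ℝ) ^ d) ^ n = ((n : ℝ) ^ n) ^ d := by
      rw [← Real.rpow_natCast, ← Real.rpow_mul (by positivity), ← Real.rpow_natCast (n : ℝ) n,
        ← Real.rpow_mul (by positivity), mul_comm]
    rw [mul_pow, mul_pow, e2, e4]
    calc _ = S / c ^ 2 * c ^ 2 * (Real.exp (-n) * Real.exp 1 ^ n) *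
          (c ^ (n - 2) * ((n : ℝ) ^ n) ^ d) := by ring
      _ = _ := by rw [e3, div_mul_cancel₀ _ (by positivity)]; ring
  rw [e1]
  have h3 : ((n ! : ℕ) : ℝ) ^ d ≤ ((n : ℝ) ^ n) ^ d :=
    Real.rpow_le_rpow (by positivity) (by exact_mod_cast Nat.factorial_le_pow n) (by linarith)
  refine mul_le_mul (mul_le_mul_of_nonneg_left h3 (by positivity)) (hS T hT t)
    (variance_nonneg _ _) (by positivity)

end Extraction

/-! ### Removing the truncation at a fixed sample size. -/

section FixedSize

variable {Ω : Type*} {mΩ : MeasurableSpace Ω} {μ : Measure Ω} {X : ℤ → ℕ → Ω → ℝ} {T : ℕ}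

/-- The difference vanishes unless |x| or |y| exceeds B. In that case 2|xy| ≤ (xy)²/u + u, and the
last term may be multiplied by the Markov ratio, which is at least 1. The weight `u` is free and is
taken to be T below. -/
theorem abs_mul_sub_clamp_mul_clamp_le {B u x y : ℝ} (hB : 0 < B) (hu : 0 < u) (n : ℕ) :
    |x * y - clamp B x * clamp B y| ≤
      (1 + (x ^ 8 + y ^ 8) / 2) / u + u * ((|x| ^ n + |y| ^ n) / B ^ n) := by
  have hpos : 0 ≤ (1 + (x ^ 8 + y ^ 8) / 2) / u + u * ((|x| ^ n + |y| ^ n) / B ^ n) := by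
    have := (Even.pow_nonneg (by decide : Even 8) x)
    have := (Even.pow_nonneg (by decide : Even 8) y)
    positivity
  by_cases h : |x| ≤ B ∧ |y| ≤ B
  · rw [clamp_eq_self h.1, clamp_eq_self h.2, sub_self, abs_zero]
    exact hpos
  · have h1 : 1 ≤ (|x| ^ n + |y| ^ n) / B ^ n := by
      rw [le_div_iff₀ (by positivity), one_mul]
      rcases not_and_or.1 h with h | h
      · have := pow_le_pow_left₀ hB.le (not_le.1 h).le n
        have : 0 ≤ |y| ^ n := by positivity
        linarith
      · have := pow_le_pow_left₀ hB.le (not_le.1 h).le n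
        have : 0 ≤ |x| ^ n := by positivity
        linarith
    have h2 : |x * y - clamp B x * clamp B y| ≤ 2 * (|x| * |y|) := by
      refine (abs_sub _ _).trans ?_
      rw [abs_mul, abs_mul]
      have := mul_le_mul (abs_clamp_le_abs hB.le x) (abs_clamp_le_abs hB.le y) (abs_nonneg _)
        (abs_nonneg _)
      linarith
    have h3 : 2 * (|x| * |y|) ≤ (|x| * |y|) ^ 2 / u + u := by
      rw [div_add' _ _ _ hu.ne', le_div_iff₀ hu]
      nlinarith [sq_nonneg (|x| * |y| - u)]
    have h4 : (|x| * |y|) ^ 2 / u ≤ (1 + (x ^ 8 + y ^ 8) / 2) / u := by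
      refine div_le_div_of_nonneg_right ?_ hu.le
      rw [mul_pow, sq_abs, sq_abs]
      nlinarith [sq_nonneg (x ^ 2 - y ^ 2), sq_nonneg (x ^ 4 - 1), sq_nonneg (y ^ 4 - 1)]
    have h5 := mul_le_mul_of_nonneg_left h1 hu.le
    linarith

theorem abs_integral_sub_truncProd_le [IsProbabilityMeasure μ] (hX : ∀ t, Measurable (X t T))
    {κ B θ u : ℝ} {n : ℕ} (hB : 0 < B) (hu : 0 < u)
    (hκ : ∀ s : ℤ, 1 ≤ s → s ≤ T →
      Integrable (fun ω => X s T ω ^ 8) μ ∧ ∫ ω, X s T ω ^ 8 ∂μ ≤ κ)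
    (hθ : ∀ s : ℤ, 1 ≤ s → s ≤ T →
      Integrable (fun ω => |X s T ω| ^ n) μ ∧ ∫ ω, |X s T ω| ^ n ∂μ ≤ θ * B ^ n)
    {k : ℕ} {l : ℤ} (h1 : 1 ≤ l - k) (h2 : l ≤ T) :
    Integrable (fun ω => X (l - k) T ω * X l T ω) μ ∧
    |∫ ω, X (l - k) T ω * X l T ω ∂μ - ∫ ω, truncProd X T B k l ω ∂μ| ≤
      (1 + κ) / u + u * (2 * θ) := by
  obtain ⟨a1, a2⟩ := hκ (l - k) h1 (by omega)
  obtain ⟨b1, b2⟩ := hκ l (by omega) h2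
  obtain ⟨c1, c2⟩ := hθ (l - k) h1 (by omega)
  obtain ⟨d1, d2⟩ := hθ l (by omega) h2
  have mU := ((stronglyMeasurable_truncProd_past (X := X) (T := T) B k l).mono
    (sigmaPast_le hX _)).aestronglyMeasurable (μ := μ)
  have iU : Integrable (truncProd X T B k l) μ :=
    Integrable.of_bound mU _ (ae_of_all _ (abs_truncProd_le hB.le k l))
  have s1 : Integrable (fun ω => X (l - k) T ω ^ 8 + X l T ω ^ 8) μ := a1.add b1
  have s2 : Integrable (fun ω => |X (l - k) T ω| ^ n + |X l T ω| ^ n) μ := c1.add d1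
  have s3 : Integrable (fun ω => 1 + (X (l - k) T ω ^ 8 + X l T ω ^ 8) / 2) μ :=
    (integrable_const 1).add (s1.div_const 2)
  have hg : Integrable (fun ω => (1 + (X (l - k) T ω ^ 8 + X l T ω ^ 8) / 2) / u +
      u * ((|X (l - k) T ω| ^ n + |X l T ω| ^ n) / B ^ n)) μ :=
    (s3.div_const u).add ((s2.div_const _).const_mul u)
  have hdiff : Integrable (fun ω => X (l - k) T ω * X l T ω - truncProd X T B k l ω) μ :=
    hg.mono' ((((hX _).mul (hX _)).aestronglyMeasurable).sub mU)
      (ae_of_all _ fun ω => abs_mul_sub_clamp_mul_clamp_le hB hu n)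
  have hXX : Integrable (fun ω => X (l - k) T ω * X l T ω) μ := by
    refine (hdiff.add iU).congr (ae_of_all _ fun ω => ?_)
    simp
  refine ⟨hXX, ?_⟩
  rw [← integral_sub hXX iU]
  refine abs_integral_le_integral_abs.trans ?_
  refine (integral_mono hdiff.abs hg
    fun ω => abs_mul_sub_clamp_mul_clamp_le hB hu n).trans ?_
  rw [integral_add (s3.div_const u) ((s2.div_const _).const_mul u), integral_div,
    integral_add (integrable_const 1) (s1.div_const 2), integral_div, integral_add a1 b1,
    integral_const_mul, integral_div, integral_add c1 d1]
  simp only [integral_const, probReal_univ, smul_eq_mul, mul_one]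
  refine add_le_add (div_le_div_of_nonneg_right (by linarith) hu.le)
    (mul_le_mul_of_nonneg_left ?_ hu.le)
  rw [div_le_iff₀ (by positivity)]
  linarith

/-- Exponential inequality for the centred sums of products `X_{l-k} X_l` along a window. -/
theorem measureReal_abs_sum_mul_ge_le [IsProbabilityMeasure μ]
    (hX : ∀ t, Measurable (X t T)) (hT : 1 ≤ T)
    {K δ κ : ℝ} (hK : 1 ≤ K) (hδ : 0 < δ) (hδ1 : δ < 1)
    (hα : ∀ (t : ℤ) (n : ℕ), AlphaLE μ (sigmaPast X T t) (sigmaFuture X T (t + n))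
      (K * (δ ^ n) ^ 3))
    (hκ : ∀ s : ℤ, 1 ≤ s → s ≤ T →
      Integrable (fun ω => X s T ω ^ 8) μ ∧ ∫ ω, X s T ω ^ 8 ∂μ ≤ κ)
    {B θ : ℝ} {n : ℕ} (hB : 0 < B)
    (hθ : ∀ s : ℤ, 1 ≤ s → s ≤ T →
      Integrable (fun ω => |X s T ω| ^ n) μ ∧ ∫ ω, |X s T ω| ^ n ∂μ ≤ θ * B ^ n)
    {k q n₀ m : ℕ} (hkq : k ≤ q) (hm : n₀ ≤ 2 * q * m) {s₀ : ℤ}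
    (hs₀ : 1 ≤ s₀ - k) (hn₀ : s₀ + n₀ ≤ T + 1) {s : ℝ} (hs : 0 ≤ s)
    (hsb : s * (q * (2 * B ^ 2)) ≤ 1) (x : ℝ) :
    μ.real {ω | 2 * x + n₀ * ((1 + κ) / T + T * (2 * θ)) ≤ |∑ i ∈ Finset.range n₀,
      (X (s₀ + i - k) T ω * X (s₀ + i) T ω - ∫ ω', X (s₀ + i - k) T ω' * X (s₀ + i) T ω' ∂μ)|} ≤
      T * θ + 4 * (8 * m * (K * (δ ^ (q + 1 - k)) ^ 3) +
        Real.exp (1 + s ^ 2 * (m * (2 * (4 * K + 4 * (1 + κ) ^ 2) * q * (k + (1 - δ)⁻¹)))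
          - s * x)) := by
  have hT0 : (0 : ℝ) < T := by exact_mod_cast hT
  have main := measureReal_abs_sum_truncProd_ge_le hX hK hδ hδ1 hα hκ hB.le hkq hm hs₀ hn₀ hs hsb x
  set E := {ω | 2 * x ≤ |∑ i ∈ Finset.range n₀,
    (truncProd X T B k (s₀ + i) ω - ∫ ω', truncProd X T B k (s₀ + i) ω' ∂μ)|} with hE
  have tail : ∀ s ∈ Finset.Icc (1 : ℤ) T, μ.real {ω | B ^ n ≤ |X s T ω| ^ n} ≤ θ := by
    intro s hs
    rw [Finset.mem_Icc] at hs
    obtain ⟨h1, h2⟩ := hθ s hs.1 hs.2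
    have := mul_meas_ge_le_integral_of_nonneg
      (ae_of_all μ fun ω => by simp only [Pi.zero_apply]; positivity) h1 (B ^ n)
    have h3 := this.trans h2
    rw [mul_comm] at h3
    exact le_of_mul_le_mul_right h3 (by positivity)
  have hsub : {ω | 2 * x + n₀ * ((1 + κ) / T + T * (2 * θ)) ≤ |∑ i ∈ Finset.range n₀,
      (X (s₀ + i - k) T ω * X (s₀ + i) T ω -
        ∫ ω', X (s₀ + i - k) T ω' * X (s₀ + i) T ω' ∂μ)|} ⊆
      (⋃ s ∈ Finset.Icc (1 : ℤ) T, {ω | B ^ n ≤ |X s T ω| ^ n}) ∪ E := by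
    intro ω hω
    by_cases hbad : ω ∈ ⋃ s ∈ Finset.Icc (1 : ℤ) T, {ω | B ^ n ≤ |X s T ω| ^ n}
    · exact Or.inl hbad
    · refine Or.inr ?_
      have hgood : ∀ s : ℤ, 1 ≤ s → s ≤ T → |X s T ω| ≤ B := by
        intro s h1 h2
        by_contra hcon
        refine hbad (Set.mem_biUnion (Finset.mem_Icc.2 ⟨h1, h2⟩) ?_)
        exact pow_le_pow_left₀ hB.le (not_le.1 hcon).le n
      simp only [hE, Set.mem_ofPred_eq] at hω ⊢
      -- Off the tail event no variable in the sample is altered by clamping, so the raw and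
      -- truncated centred sums differ only by a nonrandom bias.
      have hdec : ∑ i ∈ Finset.range n₀, (X (s₀ + i - k) T ω * X (s₀ + i) T ω -
          ∫ ω', X (s₀ + i - k) T ω' * X (s₀ + i) T ω' ∂μ) =
          ∑ i ∈ Finset.range n₀,
            (truncProd X T B k (s₀ + i) ω - ∫ ω', truncProd X T B k (s₀ + i) ω' ∂μ) -
          ∑ i ∈ Finset.range n₀, (∫ ω', X (s₀ + i - k) T ω' * X (s₀ + i) T ω' ∂μ -
            ∫ ω', truncProd X T B k (s₀ + i) ω' ∂μ) := by
        rw [← Finset.sum_sub_distrib]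
        refine Finset.sum_congr rfl fun i hi => ?_
        have hi := Finset.mem_range.1 hi
        have e : truncProd X T B k (s₀ + i) ω = X (s₀ + i - k) T ω * X (s₀ + i) T ω := by
          unfold truncProd
          rw [clamp_eq_self (hgood _ (by omega) (by omega)),
            clamp_eq_self (hgood _ (by omega) (by omega))]
        rw [e]; ring
      have hbias : |∑ i ∈ Finset.range n₀, (∫ ω', X (s₀ + i - k) T ω' * X (s₀ + i) T ω' ∂μ -
            ∫ ω', truncProd X T B k (s₀ + i) ω' ∂μ)| ≤
          n₀ * ((1 + κ) / T + T * (2 * θ)) := by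
        refine (Finset.abs_sum_le_sum_abs _ _).trans ?_
        calc _ ≤ ∑ i ∈ Finset.range n₀, ((1 + κ) / T + T * (2 * θ)) :=
              Finset.sum_le_sum fun i hi => by
                have hi := Finset.mem_range.1 hi
                exact (abs_integral_sub_truncProd_le hX hB hT0 hκ hθ (by omega) (by omega)).2
          _ = _ := by rw [Finset.sum_const, Finset.card_range, nsmul_eq_mul]
      rw [hdec] at hω
      have := hω.trans (abs_sub _ _)
      linarith
  calc _ ≤ μ.real ((⋃ s ∈ Finset.Icc (1 : ℤ) T, {ω | B ^ n ≤ |X s T ω| ^ n}) ∪ E) :=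
        measureReal_mono hsub
    _ ≤ _ := measureReal_union_le _ _
    _ ≤ _ := by
        refine add_le_add ((measureReal_biUnion_finset_le _ _).trans ?_) main
        refine (Finset.sum_le_sum tail).trans (le_of_eq ?_)
        simp

end FixedSize

/-! ### Consequences of the growth conditions on P, N and T. -/

section Growth

variable {d : ℝ} {P N : ℕ → ℕ} {R : ℕ → ℝ}

theorem eventually_log_le (hR : Tendsto R atTop atTop)
    (hR_log : (fun T : ℕ => R T * Real.log (T : ℝ)) =o[atTop]
      fun T : ℕ => ((N T : ℝ) / (P T : ℝ)) ^ (1 / (3 + 4 * d))) {c : ℝ} (hc : 0 < c) :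
    ∀ᶠ T : ℕ in atTop, Real.log T ≤ c * ((N T : ℝ) / (P T : ℝ)) ^ (1 / (3 + 4 * d)) := by
  filter_upwards [hR_log.def hc, hR.eventually_ge_atTop 1] with T h1 h2
  have h3 : 0 ≤ Real.log T := Real.log_natCast_nonneg T
  rw [Real.norm_eq_abs, Real.norm_eq_abs, abs_of_nonneg (mul_nonneg (by linarith) h3),
    abs_of_nonneg (by positivity)] at h1
  nlinarith

/-- The constant in the bound on log T is chosen so that its power 3 + 4d is 1/C'; replacing `C` by
`max C 1` makes that negative power legitimate. -/
theorem eventually_mul_log_rpow_mul_le (hd : 1 / 2 ≤ d)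
    (hPN : ∀ T : ℕ, 2 ≤ T → 2 ≤ 1 + P T ∧ 1 + P T ≤ N T ∧ N T ≤ T)
    (hR : Tendsto R atTop atTop)
    (hR_log : (fun T : ℕ => R T * Real.log (T : ℝ)) =o[atTop]
      fun T : ℕ => ((N T : ℝ) / (P T : ℝ)) ^ (1 / (3 + 4 * d))) (C : ℝ) :
    ∀ᶠ T : ℕ in atTop, C * Real.log T ^ (3 + 4 * d) * P T ≤ N T := by
  set C' := max C 1 with hC'
  have hC0 : 0 < C' := lt_max_of_lt_right one_pos
  have hr : 0 < 3 + 4 * d := by linarith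
  have hc : 0 < C' ^ (-(1 / (3 + 4 * d))) := Real.rpow_pos_of_pos hC0 _
  filter_upwards [eventually_log_le hR hR_log hc, eventually_ge_atTop 2] with T h1 h2
  obtain ⟨p1, p2, p3⟩ := hPN T h2
  have hP0 : (0 : ℝ) < P T := by exact_mod_cast (by omega : 0 < P T)
  have hN0 : (0 : ℝ) < N T := by exact_mod_cast (by omega : 0 < N T)
  have h3 : 0 ≤ Real.log T := Real.log_natCast_nonneg T
  have h4 := Real.rpow_le_rpow h3 h1 hr.le
  rw [Real.mul_rpow hc.le (by positivity), ← Real.rpow_mul hC0.le,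
    ← Real.rpow_mul (by positivity), neg_mul, one_div_mul_cancel hr.ne', Real.rpow_one,
    Real.rpow_neg_one] at h4
  have h5 : C * Real.log T ^ (3 + 4 * d) ≤ C' * Real.log T ^ (3 + 4 * d) :=
    mul_le_mul_of_nonneg_right (le_max_left _ _) (by positivity)
  have h6 := mul_le_mul_of_nonneg_left h4 hC0.le
  rw [← mul_assoc, mul_inv_cancel₀ hC0.ne', one_mul] at h6
  have h7 := mul_le_mul_of_nonneg_right (h5.trans h6) hP0.le
  rwa [div_mul_cancel₀ _ hP0.ne'] at h7

/-- Since (1 + 2d)/(4 + 6d) ≤ 1/2, P is o(√N). This absorbs the bias of the mean matrix. -/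
theorem eventually_sq_le (hd : 1 / 2 ≤ d)
    (hPN : ∀ T : ℕ, 2 ≤ T → 2 ≤ 1 + P T ∧ 1 + P T ≤ N T ∧ N T ≤ T)
    (hP : (fun T : ℕ => (P T : ℝ)) =o[atTop]
      fun T : ℕ => (N T : ℝ) ^ ((1 + 2 * d) / (4 + 6 * d))) {ε : ℝ} (hε : 0 < ε) :
    ∀ᶠ T : ℕ in atTop, (P T : ℝ) ^ 2 ≤ ε * N T := by
  filter_upwards [hP.def (Real.sqrt_pos.2 hε), eventually_ge_atTop 2] with T h1 h2
  obtain ⟨p1, p2, p3⟩ := hPN T h2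
  have hN1 : (1 : ℝ) ≤ N T := by exact_mod_cast (by omega : 1 ≤ N T)
  rw [Real.norm_eq_abs, Real.norm_eq_abs, abs_of_nonneg (by positivity),
    abs_of_nonneg (by positivity)] at h1
  have h3 : (N T : ℝ) ^ ((1 + 2 * d) / (4 + 6 * d)) ≤ (N T : ℝ) ^ ((1 : ℝ) / 2) := by
    refine Real.rpow_le_rpow_of_exponent_le hN1 ?_
    rw [div_le_div_iff₀ (by linarith) two_pos]
    linarith
  rw [← Real.sqrt_eq_rpow] at h3
  have h4 := h1.trans (mul_le_mul_of_nonneg_left h3 (Real.sqrt_nonneg _))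
  have h5 := pow_le_pow_left₀ (by positivity) h4 2
  rwa [mul_pow, Real.sq_sqrt hε.le, Real.sq_sqrt (by positivity)] at h5

/-- Bounding log T by ε (N/P)^{1/(3+4d)} leaves P to the power 3 - 1/(3+4d). Inserting the bound on
P, the exponents of N add up to exactly 1, which explains the exponent (1 + 2d)/(4 + 6d). -/
theorem eventually_cube_mul_log_le (hd : 1 / 2 ≤ d)
    (hPN : ∀ T : ℕ, 2 ≤ T → 2 ≤ 1 + P T ∧ 1 + P T ≤ N T ∧ N T ≤ T)
    (hP : (fun T : ℕ => (P T : ℝ)) =o[atTop]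
      fun T : ℕ => (N T : ℝ) ^ ((1 + 2 * d) / (4 + 6 * d)))
    (hR : Tendsto R atTop atTop)
    (hR_log : (fun T : ℕ => R T * Real.log (T : ℝ)) =o[atTop]
      fun T : ℕ => ((N T : ℝ) / (P T : ℝ)) ^ (1 / (3 + 4 * d))) {ε : ℝ} (hε : 0 < ε) :
    ∀ᶠ T : ℕ in atTop, (P T : ℝ) ^ 3 * Real.log T ≤ ε * N T := by
  filter_upwards [hP.def one_pos, eventually_log_le hR hR_log hε, eventually_ge_atTop 2]
    with T h1 h2 h3
  obtain ⟨p1, p2, p3⟩ := hPN T h3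
  have hP0 : (0 : ℝ) < P T := by exact_mod_cast (by omega : 0 < P T)
  have hN0 : (0 : ℝ) < N T := by exact_mod_cast (by omega : 0 < N T)
  have hr : 0 < 3 + 4 * d := by linarith
  have hr' : 0 < 4 + 6 * d := by linarith
  rw [one_mul, Real.norm_eq_abs, Real.norm_eq_abs, abs_of_nonneg (by positivity),
    abs_of_nonneg (by positivity)] at h1
  have hexp : 0 ≤ 3 - 1 / (3 + 4 * d) := by
    have : 1 / (3 + 4 * d) ≤ 1 := by rw [div_le_one hr]; linarith
    linarith
  have h4 := Real.rpow_le_rpow hP0.le h1 hexp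
  rw [← Real.rpow_mul hN0.le] at h4
  calc (P T : ℝ) ^ 3 * Real.log T
      ≤ (P T : ℝ) ^ 3 * (ε * ((N T : ℝ) / (P T : ℝ)) ^ (1 / (3 + 4 * d))) := by gcongr
    _ = ε * ((P T : ℝ) ^ (3 - 1 / (3 + 4 * d)) * (N T : ℝ) ^ (1 / (3 + 4 * d))) := by
        rw [Real.div_rpow hN0.le hP0.le, Real.rpow_sub hP0]
        norm_cast
        ring
    _ ≤ ε * ((N T : ℝ) ^ ((1 + 2 * d) / (4 + 6 * d) * (3 - 1 / (3 + 4 * d))) *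
          (N T : ℝ) ^ (1 / (3 + 4 * d))) := by gcongr
    _ = ε * N T := by
        rw [← Real.rpow_add hN0]
        have e : (1 + 2 * d) / (4 + 6 * d) * (3 - 1 / (3 + 4 * d)) + 1 / (3 + 4 * d) = 1 := by
          field_simp
          ring
        rw [e, Real.rpow_one]

end Growth

/-! ### Choice of truncation level, block length and exponential parameter. -/

section Deviation

variable {Ω : Type*} {mΩ : MeasurableSpace Ω} {μ : Measure Ω} {X : ℤ → ℕ → Ω → ℝ}

theorem sum_Icc_eq_sum_range (g : ℤ → ℝ) (a : ℤ) (n : ℕ) :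
    ∑ l ∈ Finset.Icc a (a + n - 1), g l = ∑ i ∈ Finset.range n, g (a + i) := by
  induction n with
  | zero => simp
  | succ n ih =>
    rw [Finset.sum_range_succ, ← ih]
    have e : Finset.Icc a (a + ((n + 1 : ℕ) : ℤ) - 1) =
        insert (a + (n : ℤ)) (Finset.Icc a (a + n - 1)) := by
      ext l
      simp only [Finset.mem_Icc, Finset.mem_insert]
      push_cast
      omega
    rw [e, Finset.sum_insert (by simp), add_comm]

theorem empCov_eq_sum_range {N T k : ℕ} (hk : k ≤ N) (t : ℤ) (ω : Ω) :
    empCov X N T t k ω = ((N : ℝ) - k)⁻¹ * ∑ i ∈ Finset.range (N - k),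
      X (t - N + k + 1 + i - k) T ω * X (t - N + k + 1 + i) T ω := by
  unfold empCov
  have e : t = t - N + k + 1 + ((N - k : ℕ) : ℤ) - 1 := by omega
  rw [Nat.abs_cast, Int.cast_natCast, Nat.abs_cast]
  rw [← sum_Icc_eq_sum_range (fun l => X (l - k) T ω * X l T ω), ← e]

theorem empCov_sub_integral {N T k : ℕ} (hk : k ≤ N) (t : ℤ)
    (hint : ∀ i ∈ Finset.range (N - k), Integrable
      (fun ω => X (t - N + k + 1 + i - k) T ω * X (t - N + k + 1 + i) T ω) μ) (ω : Ω) :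
    empCov X N T t k ω - ∫ ω', empCov X N T t k ω' ∂μ =
      ((N : ℝ) - k)⁻¹ * ∑ i ∈ Finset.range (N - k),
        (X (t - N + k + 1 + i - k) T ω * X (t - N + k + 1 + i) T ω -
          ∫ ω', X (t - N + k + 1 + i - k) T ω' * X (t - N + k + 1 + i) T ω' ∂μ) := by
  simp only [empCov_eq_sum_range hk]
  rw [integral_const_mul, integral_finsetSum _ hint, ← mul_sub, Finset.sum_sub_distrib]

set_option maxHeartbeats 1000000 in
/-- Deviation inequality for one empirical autocovariance, for a single large sample size. -/
theorem measureReal_abs_empCov_sub_ge_le [IsProbabilityMeasure μ] {T P N : ℕ}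
    (hX : ∀ t, Measurable (X t T)) {K δ κ A₀ c d : ℝ} (hd : 1 / 2 ≤ d)
    (hK : 1 ≤ K) (hδ : 0 < δ) (hδ1 : δ < 1) (hκ0 : 0 ≤ κ)
    (hα : ∀ (t : ℤ) (n : ℕ), AlphaLE μ (sigmaPast X T t) (sigmaFuture X T (t + n))
      (K * (δ ^ n) ^ 3))
    (hκ : ∀ s : ℤ, 1 ≤ s → s ≤ T →
      Integrable (fun ω => X s T ω ^ 8) μ ∧ ∫ ω, X s T ω ^ 8 ∂μ ≤ κ)
    (hA₀ : 0 ≤ A₀) (hc : 0 < c)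
    (hmom : ∀ s : ℤ, 1 ≤ s → s ≤ T → ∀ n : ℕ, 2 ≤ n →
      Integrable (fun ω => |X s T ω| ^ n) μ ∧
      ∫ ω, |X s T ω| ^ n ∂μ ≤ A₀ * Real.exp (-n) * (Real.exp 1 * c * (n : ℝ) ^ d) ^ n)
    (hP1 : 1 ≤ P) (hPN : 1 + P ≤ N) (hNT : N ≤ T) (hlog : 1 ≤ Real.log T)
    (hlog' : (1 + κ + 2 * A₀) ^ 2 ≤ Real.log T)
    (hgrow : 4 * (-6 / Real.log δ + 2) ^ 2 * ((Real.exp 1 * c * 7 ^ d) ^ 2) ^ 2 *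
      Real.log T ^ (3 + 4 * d) * P ≤ N)
    (hgrow' : (-6 / Real.log δ + 2) * Real.log T ^ (3 + 4 * d) * P ≤ N)
    (hgrow'' : 2 * Real.log T ^ (3 + 4 * d) * P ≤ N)
    {t : ℤ} (ht : N ≤ t) (ht' : t ≤ T) {k : ℕ} (hk : k ≤ P) :
    μ.real {ω | 6 * (4 * (4 * K + 4 * (1 + κ) ^ 2) * (1 + (1 - δ)⁻¹) + 4) *
        Real.sqrt (P * Real.log T / N) ≤
        |empCov X N T t k ω - ∫ ω', empCov X N T t k ω' ∂μ|} ≤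
      (A₀ + 64 * K + 4 * Real.exp 1) / T ^ 4 := by
  set ℓ := Real.log T with hℓ
  set C := 4 * K + 4 * (1 + κ) ^ 2 with hC
  have hC0 : 0 ≤ C := by positivity
  have hT1 : 1 ≤ T := by omega
  have hT0 : (0 : ℝ) < T := by exact_mod_cast hT1
  have hT1' : (1 : ℝ) ≤ T := by exact_mod_cast hT1
  have hP0 : (0 : ℝ) < P := by exact_mod_cast hP1
  have hP1' : (1 : ℝ) ≤ P := by exact_mod_cast hP1
  have hN0 : (0 : ℝ) < N := by exact_mod_cast (by omega : 0 < N)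
  have hN1' : (1 : ℝ) ≤ N := by exact_mod_cast (by omega : 1 ≤ N)
  have hNT' : (N : ℝ) ≤ T := by exact_mod_cast hNT
  have hℓ0 : 0 < ℓ := by linarith
  have hlogδ : Real.log δ < 0 := Real.log_neg hδ hδ1
  have hδ' : 0 < 1 - δ := by linarith
  set cg := -6 / Real.log δ with hcg
  have hcg0 : 0 < cg := div_pos_of_neg_of_neg (by norm_num) hlogδ
  have hℓr : ℓ ≤ ℓ ^ (3 + 4 * d) := by
    conv_lhs => rw [← Real.rpow_one ℓ]
    exact Real.rpow_le_rpow_of_exponent_le hlog (by linarith)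
  -- truncation level
  set n := ⌈6 * ℓ⌉₊ with hn
  have hn6 : 6 * ℓ ≤ n := Nat.le_ceil _
  have hn7 : (n : ℝ) ≤ 7 * ℓ := by
    have := (Nat.ceil_lt_add_one (by positivity : 0 ≤ 6 * ℓ)).le
    linarith
  have hn2 : 2 ≤ n := by
    have : (2 : ℝ) ≤ n := by linarith
    exact_mod_cast this
  -- As n ≥ 6 log T, the moment of order `n` gives tail probabilities at most A₀ T⁻⁶ at this level.
  set B := Real.exp 1 * c * (n : ℝ) ^ d with hBdef
  have hn0 : (0 : ℝ) < n := by linarith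
  have hB : 0 < B := by positivity
  have hBle : B ^ 2 ≤ (Real.exp 1 * c * 7 ^ d) ^ 2 * ℓ ^ (2 * d) := by
    have h1 : (n : ℝ) ^ d ≤ 7 ^ d * ℓ ^ d := by
      rw [← Real.mul_rpow (by norm_num) hℓ0.le]
      exact Real.rpow_le_rpow hn0.le hn7 (by linarith)
    have h2 : B ≤ Real.exp 1 * c * 7 ^ d * ℓ ^ d := by
      rw [hBdef, mul_assoc _ ((7 : ℝ) ^ d)]
      exact mul_le_mul_of_nonneg_left h1 (by positivity)
    have h3 := pow_le_pow_left₀ hB.le h2 2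
    rwa [mul_pow _ (ℓ ^ d), ← Real.rpow_natCast (ℓ ^ d), ← Real.rpow_mul hℓ0.le,
      mul_comm d] at h3
  -- block length
  set g := ⌈cg * ℓ⌉₊ with hg
  have hg1 : cg * ℓ ≤ g := Nat.le_ceil _
  have hg2 : (g : ℝ) ≤ (cg + 1) * ℓ := by
    have := (Nat.ceil_lt_add_one (by positivity : 0 ≤ cg * ℓ)).le
    linarith
  -- `P` covers the reach of the lag k ≤ P; the remaining g ≥ 6 log T / |log δ| makes δ^g ≤ T⁻⁶.
  set q := P + g with hq
  have hqP : (P : ℝ) ≤ P * ℓ := le_mul_of_one_le_right hP0.le hlog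
  have hqle : (q : ℝ) ≤ (cg + 2) * (P * ℓ) := by
    have : (q : ℝ) = P + g := by rw [hq]; push_cast; ring
    rw [this]
    have h1 : ℓ ≤ P * ℓ := le_mul_of_one_le_left hℓ0.le hP1'
    have h2 : (cg + 1) * ℓ ≤ (cg + 1) * (P * ℓ) := by gcongr
    linarith
  have hqN : (q : ℝ) ≤ N := by
    refine hqle.trans (le_trans ?_ hgrow')
    rw [mul_assoc _ (ℓ ^ _), mul_comm (P : ℝ)]
    gcongr
  have hqpos : 0 < q := by omega
  have hq0 : (0 : ℝ) < q := by exact_mod_cast hqpos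
  set m := N / (2 * q) + 1 with hm
  have hmN : N ≤ 2 * q * m := (Nat.lt_mul_div_succ N (by omega)).le
  have hmq : (m : ℝ) * q ≤ 2 * N := by
    have h1 : N / (2 * q) * (2 * q) ≤ N := Nat.div_mul_le_self _ _
    have h2 : ((N / (2 * q) : ℕ) : ℝ) * (2 * q) ≤ N := by exact_mod_cast h1
    have h3 : (m : ℝ) = ((N / (2 * q) : ℕ) : ℝ) + 1 := by rw [hm]; push_cast; ring
    rw [h3, add_mul]
    linarith
  have hm2T : (m : ℝ) ≤ 2 * T := by
    have : (m : ℝ) ≤ m * q := le_mul_of_one_le_right (by positivity) (by exact_mod_cast hqpos)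
    linarith
  -- exponential parameter
  set s := Real.sqrt (ℓ / (N * P)) with hs
  -- Here s x = A log T. The first summand of `A` cancels the variance term s² · m · w, and the 4
  -- leaves the factor T⁻⁴.
  set A := 4 * C * (1 + (1 - δ)⁻¹) + 4 with hA
  have hinv : 0 < (1 - δ)⁻¹ := inv_pos.2 hδ'
  have hA4 : 4 ≤ A := by
    have : 0 ≤ 4 * C * (1 + (1 - δ)⁻¹) := by positivity
    linarith
  set x := A * Real.sqrt (N * P * ℓ) with hx
  have hs0 : 0 ≤ s := Real.sqrt_nonneg _
  have hs2 : s ^ 2 = ℓ / (N * P) := Real.sq_sqrt (by positivity)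
  have hsx : s * x = A * ℓ := by
    have : s * Real.sqrt (N * P * ℓ) = ℓ := by
      rw [hs, ← Real.sqrt_mul (by positivity)]
      have e : ℓ / (N * P) * (N * P * ℓ) = ℓ ^ 2 := by field_simp
      rw [e, Real.sqrt_sq hℓ0.le]
    rw [hx, mul_left_comm, this]
  -- After squaring, the powers of log T are 1 from s², 2 from q² and 4d from B⁴, and the rest is of
  -- order P/N. This is the origin of the exponent 3 + 4d.
  have hsb : s * (q * (2 * B ^ 2)) ≤ 1 := by
    rw [← sq_le_one_iff₀ (by positivity), mul_pow, hs2, mul_pow, mul_pow, div_mul_eq_mul_div,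
      div_le_one (by positivity)]
    have h1 : (q : ℝ) ^ 2 ≤ ((cg + 2) * (P * ℓ)) ^ 2 := pow_le_pow_left₀ hq0.le hqle 2
    have h2 : (B ^ 2) ^ 2 ≤ ((Real.exp 1 * c * 7 ^ d) ^ 2 * ℓ ^ (2 * d)) ^ 2 :=
      pow_le_pow_left₀ (by positivity) hBle 2
    have e1 : ℓ ^ (3 + 4 * d) = ℓ ^ 3 * (ℓ ^ (2 * d)) ^ 2 := by
      rw [← Real.rpow_natCast (ℓ ^ (2 * d)), ← Real.rpow_mul hℓ0.le, ← Real.rpow_natCast ℓ,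
        ← Real.rpow_add hℓ0]
      congr 1
      push_cast
      ring
    rw [e1] at hgrow
    calc ℓ * ((q : ℝ) ^ 2 * (2 ^ 2 * (B ^ 2) ^ 2))
        ≤ ℓ * (((cg + 2) * (P * ℓ)) ^ 2 * (2 ^ 2 *
          ((Real.exp 1 * c * 7 ^ d) ^ 2 * ℓ ^ (2 * d)) ^ 2)) := by gcongr
      _ = (4 * (cg + 2) ^ 2 * ((Real.exp 1 * c * 7 ^ d) ^ 2) ^ 2 *
          (ℓ ^ 3 * (ℓ ^ (2 * d)) ^ 2) * P) * P := by ring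
      _ ≤ N * P := by gcongr
  have hτ : ∀ j : ℕ, Real.exp (-(j * ℓ)) = ((T : ℝ) ^ j)⁻¹ := by
    intro j
    rw [Real.exp_neg, Real.exp_nat_mul, Real.exp_log hT0]
  have hexpn : Real.exp (-n) ≤ ((T : ℝ) ^ 6)⁻¹ := by
    rw [← hτ 6, Real.exp_le_exp]
    push_cast
    linarith
  set θ := A₀ * Real.exp (-n) with hθ
  have hθle : θ ≤ A₀ * ((T : ℝ) ^ 6)⁻¹ := mul_le_mul_of_nonneg_left hexpn hA₀
  have hθ' : ∀ s : ℤ, 1 ≤ s → s ≤ T →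
      Integrable (fun ω => |X s T ω| ^ n) μ ∧ ∫ ω, |X s T ω| ^ n ∂μ ≤ θ * B ^ n :=
    fun s h1 h2 => hmom s h1 h2 n hn2
  have hkN : k ≤ N := by omega
  set n₀ := N - k with hn₀
  have hint : ∀ i ∈ Finset.range n₀, Integrable
      (fun ω => X (t - N + k + 1 + i - k) T ω * X (t - N + k + 1 + i) T ω) μ := by
    intro i hi
    have hi := Finset.mem_range.1 hi
    exact (abs_integral_sub_truncProd_le hX hB hT0 hκ hθ' (by omega) (by omega)).1
  have main := measureReal_abs_sum_mul_ge_le (μ := μ) hX hT1 hK hδ hδ1 hα hκ hB hθ'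
    (k := k) (q := q) (n₀ := n₀) (m := m) (by omega) (by omega) (s₀ := t - N + k + 1)
    (by omega) (by omega) hs0 hsb x
  refine (measureReal_mono ?_).trans (main.trans ?_)
  · intro ω hω
    simp only [Set.mem_ofPred_eq] at hω ⊢
    rw [empCov_sub_integral hkN t hint ω, abs_mul] at hω
    set Q := |∑ i ∈ Finset.range (N - k), (X (t - N + k + 1 + i - k) T ω *
      X (t - N + k + 1 + i) T ω -
        ∫ ω', X (t - N + k + 1 + i - k) T ω' * X (t - N + k + 1 + i) T ω' ∂μ)|
    have hkP : (k : ℝ) ≤ P := by exact_mod_cast hk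
    have h2P : 2 * (P : ℝ) ≤ N := by
      refine le_trans ?_ hgrow''
      have : 2 ≤ 2 * ℓ ^ (3 + 4 * d) := by linarith
      exact mul_le_mul_of_nonneg_right this hP0.le
    have hNk : (N : ℝ) / 2 ≤ N - k := by linarith
    have hNk0 : (0 : ℝ) < N - k := by linarith
    rw [abs_of_pos (inv_pos.2 hNk0), inv_mul_eq_div, le_div_iff₀ hNk0] at hω
    have e1 : Real.sqrt (P * ℓ / N) * N = Real.sqrt (N * P * ℓ) := by
      have e2 : (N : ℝ) * P * ℓ = P * ℓ / N * N ^ 2 := by field_simp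
      rw [e2, Real.sqrt_mul (by positivity), Real.sqrt_sq hN0.le]
    -- The normalisation N - k ≥ N/2 turns the constant 6A into 3x: two x for the stochastic part,
    -- one to absorb the truncation bias.
    have h1 : 3 * x ≤ Q := by
      refine le_trans ?_ hω
      calc 3 * x = 6 * A * Real.sqrt (P * ℓ / N) * (N / 2) := by rw [hx, ← e1]; ring
        _ ≤ _ := by gcongr
    have h2 : (n₀ : ℝ) ≤ T := by
      have : n₀ ≤ T := by omega
      exact_mod_cast this
    have h3 : n₀ * ((1 + κ) / T + T * (2 * θ)) ≤ 1 + κ + 2 * A₀ := by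
      calc n₀ * ((1 + κ) / T + T * (2 * θ)) ≤ T * ((1 + κ) / T + T * (2 * (A₀ * ((T : ℝ) ^ 6)⁻¹))) := by
            gcongr
        _ = 1 + κ + 2 * A₀ * ((T : ℝ) ^ 4)⁻¹ := by field_simp
        _ ≤ 1 + κ + 2 * A₀ := by
            have : ((T : ℝ) ^ 4)⁻¹ ≤ 1 := inv_le_one_of_one_le₀ (one_le_pow₀ hT1')
            have := mul_le_of_le_one_right (by positivity : 0 ≤ 2 * A₀) this
            linarith
    have h4 : 1 + κ + 2 * A₀ ≤ x := by
      have h5 : 1 + κ + 2 * A₀ ≤ Real.sqrt ℓ := Real.le_sqrt_of_sq_le hlog'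
      have h6 : Real.sqrt ℓ ≤ Real.sqrt (N * P * ℓ) := by
        refine Real.sqrt_le_sqrt (le_mul_of_one_le_left hℓ0.le ?_)
        exact one_le_mul_of_one_le_of_one_le hN1' hP1'
      have h7 : Real.sqrt (N * P * ℓ) ≤ x :=
        le_mul_of_one_le_left (Real.sqrt_nonneg _) (by linarith)
      linarith
    linarith
  · have h1 : (δ ^ (q + 1 - k)) ^ 3 ≤ ((T : ℝ) ^ 6)⁻¹ := by
      rw [← pow_mul]
      refine (pow_le_pow_of_le_one hδ.le hδ1.le (by omega : g ≤ (q + 1 - k) * 3)).trans ?_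
      rw [← hτ 6, ← Real.exp_log hδ, ← Real.exp_nat_mul, Real.exp_le_exp]
      have e : cg * ℓ * Real.log δ = -(6 * ℓ) := by
        have := hlogδ.ne
        rw [hcg]; field_simp
      have := mul_le_mul_of_nonpos_right hg1 hlogδ.le
      push_cast
      linarith
    have h2 : Real.exp (1 + s ^ 2 * (m * (2 * C * q * (k + (1 - δ)⁻¹))) - s * x) ≤
        Real.exp 1 * ((T : ℝ) ^ 4)⁻¹ := by
      rw [← hτ 4, ← Real.exp_add, Real.exp_le_exp, hsx, hs2]
      have hkP : (k : ℝ) ≤ P := by exact_mod_cast hk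
      have h3 : (k : ℝ) + (1 - δ)⁻¹ ≤ P * (1 + (1 - δ)⁻¹) := by
        have := le_mul_of_one_le_left hinv.le hP1'
        linarith
      have h4 : m * (2 * C * q * (k + (1 - δ)⁻¹)) ≤
          2 * C * (2 * N) * (P * (1 + (1 - δ)⁻¹)) := by
        calc m * (2 * C * q * (k + (1 - δ)⁻¹)) = 2 * C * (m * q) * (k + (1 - δ)⁻¹) := by ring
          _ ≤ _ := by gcongr
      have h5 : ℓ / (N * P) * (m * (2 * C * q * (k + (1 - δ)⁻¹))) ≤
          4 * C * (1 + (1 - δ)⁻¹) * ℓ := by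
        refine (mul_le_mul_of_nonneg_left h4 (by positivity)).trans (le_of_eq ?_)
        field_simp
        ring
      push_cast
      rw [hA, add_mul]
      linarith
    have h3 : (T : ℝ) * θ ≤ A₀ * ((T : ℝ) ^ 4)⁻¹ := by
      refine (mul_le_mul_of_nonneg_left hθle hT0.le).trans ?_
      rw [mul_left_comm]
      refine mul_le_mul_of_nonneg_left ?_ hA₀
      rw [← div_eq_mul_inv, div_le_iff₀ (by positivity)]
      have : ((T : ℝ) ^ 4)⁻¹ * T ^ 6 = T ^ 2 := by field_simp
      rw [this]
      exact le_self_pow₀ hT1' two_ne_zero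
    have h4 : 8 * (m : ℝ) * (K * (δ ^ (q + 1 - k)) ^ 3) ≤ 16 * K * ((T : ℝ) ^ 4)⁻¹ := by
      calc 8 * (m : ℝ) * (K * (δ ^ (q + 1 - k)) ^ 3) ≤ 8 * (2 * T) * (K * ((T : ℝ) ^ 6)⁻¹) := by
            gcongr
        _ = 16 * K * (T * ((T : ℝ) ^ 6)⁻¹) := by ring
        _ ≤ 16 * K * ((T : ℝ) ^ 4)⁻¹ := by
            refine mul_le_mul_of_nonneg_left ?_ (by positivity)
            rw [← div_eq_mul_inv, div_le_iff₀ (by positivity)]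
            have : ((T : ℝ) ^ 4)⁻¹ * T ^ 6 = T ^ 2 := by field_simp
            rw [this]
            exact le_self_pow₀ hT1' two_ne_zero
    rw [div_eq_mul_inv]
    linarith

end Deviation

/-! ### Uniform almost sure bounds by Borel–Cantelli. -/

section AlmostSure

variable {Ω : Type*} {mΩ : MeasurableSpace Ω} {μ : Measure Ω} {X : ℤ → ℕ → Ω → ℝ}

/-- Uniform moment and mixing bounds of an array. -/
structure HasUniformBounds (μ : Measure Ω) (X : ℤ → ℕ → Ω → ℝ) (d K δ κ A₀ c : ℝ) : Prop where
  one_le_K : 1 ≤ K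
  δ_pos : 0 < δ
  δ_lt_one : δ < 1
  κ_nonneg : 0 ≤ κ
  A₀_nonneg : 0 ≤ A₀
  c_pos : 0 < c
  alphaLE : ∀ T : ℕ, 1 ≤ T → ∀ (t : ℤ) (n : ℕ),
    AlphaLE μ (sigmaPast X T t) (sigmaFuture X T (t + n)) (K * (δ ^ n) ^ 3)
  pow_four : ∀ (T : ℕ) (s : ℤ), 1 ≤ s → s ≤ T →
    Integrable (fun ω => X s T ω ^ 4) μ ∧ ∫ ω, X s T ω ^ 4 ∂μ ≤ κ
  pow_eight : ∀ (T : ℕ) (s : ℤ), 1 ≤ s → s ≤ T →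
    Integrable (fun ω => X s T ω ^ 8) μ ∧ ∫ ω, X s T ω ^ 8 ∂μ ≤ κ
  moment : ∀ (T : ℕ) (s : ℤ), 1 ≤ s → s ≤ T → ∀ n : ℕ, 2 ≤ n →
    Integrable (fun ω => |X s T ω| ^ n) μ ∧
    ∫ ω, |X s T ω| ^ n ∂μ ≤ A₀ * Real.exp (-n) * (Real.exp 1 * c * (n : ℝ) ^ d) ^ n

theorem exists_hasUniformBounds [IsProbabilityMeasure μ] {f : ℝ → ℝ → ℝ} {d : ℝ}
    (h_stat : IsLocallyStationary μ X f) (h_mixing : IsGeometricallyMixing μ X)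
    (h_bounded : IsSpectrallyBounded f) (h_moment : BernsteinCondition μ X d) :
    ∃ K δ κ A₀ c : ℝ, HasUniformBounds μ X d K δ κ A₀ c := by
  obtain ⟨K, δ, hK, hδ, hδ1, hα⟩ := h_mixing.exists_alphaLE
  obtain ⟨S, hS0, hS⟩ := h_stat.exists_variance_le h_bounded
  obtain ⟨c, hc, hmom⟩ := h_moment.exists_moment_le hS
  set b : ℕ → ℝ := fun n =>
    S / c ^ 2 * Real.exp (-n) * (Real.exp 1 * c * (n : ℝ) ^ d) ^ n with hb
  have heven : ∀ (T : ℕ) (s : ℤ), 1 ≤ s → s ≤ T → ∀ n : ℕ, 2 ≤ n → Even n →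
      Integrable (fun ω => X s T ω ^ n) μ ∧ ∫ ω, X s T ω ^ n ∂μ ≤ b n := by
    intro T s h1 h2 n hn he
    have := hmom T s h1 h2 n hn
    simpa only [he.pow_abs] using this
  refine ⟨K, δ, max (b 4) (b 8), S / c ^ 2, c, hK, hδ, hδ1, ?_, by positivity, hc, hα, ?_, ?_,
    hmom⟩
  · exact le_max_of_le_left (by positivity)
  · intro T s h1 h2
    obtain ⟨h3, h4⟩ := heven T s h1 h2 4 (by norm_num) (by decide)
    exact ⟨h3, h4.trans (le_max_left _ _)⟩
  · intro T s h1 h2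
    obtain ⟨h3, h4⟩ := heven T s h1 h2 8 (by norm_num) (by decide)
    exact ⟨h3, h4.trans (le_max_right _ _)⟩

theorem tendsto_log_natCast_atTop : Tendsto (fun T : ℕ => Real.log (T : ℝ)) atTop atTop :=
  Real.tendsto_log_atTop.comp tendsto_natCast_atTop_atTop

/-- Uniform almost sure rate for the empirical autocovariances. -/
theorem exists_ae_eventually_abs_empCov_sub_le [IsProbabilityMeasure μ]
    {d K δ κ A₀ c : ℝ} (h : HasUniformBounds μ X d K δ κ A₀ c) (hd : 1 / 2 ≤ d)
    (hX : ∀ (t : ℤ) (T : ℕ), 1 ≤ T → Measurable (X t T)) {P N : ℕ → ℕ} {R : ℕ → ℝ}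
    (hPN : ∀ T : ℕ, 2 ≤ T → 2 ≤ 1 + P T ∧ 1 + P T ≤ N T ∧ N T ≤ T)
    (hR : Tendsto R atTop atTop)
    (hR_log : (fun T : ℕ => R T * Real.log (T : ℝ)) =o[atTop]
      fun T : ℕ => ((N T : ℝ) / (P T : ℝ)) ^ (1 / (3 + 4 * d))) :
    ∃ A : ℝ, 0 < A ∧ ∀ᵐ ω ∂μ, ∀ᶠ T : ℕ in atTop, ∀ t ∈ Set.Icc (N T) T, ∀ k ≤ P T,
      |empCov X (N T) T t k ω - ∫ ω', empCov X (N T) T t k ω' ∂μ| ≤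
        A * Real.sqrt (P T * Real.log T / N T) := by
  have hδ' : 0 < (1 - δ)⁻¹ := inv_pos.2 (by linarith [h.δ_lt_one])
  have hK0 : 0 < K := by linarith [h.one_le_K]
  have hA₀ := h.A₀_nonneg
  set A := 6 * (4 * (4 * K + 4 * (1 + κ) ^ 2) * (1 + (1 - δ)⁻¹) + 4) with hA
  set D := A₀ + 64 * K + 4 * Real.exp 1 with hD
  have hD0 : 0 ≤ D := by positivity
  refine ⟨A, by positivity, ?_⟩
  set bad : ℕ → Set Ω := fun T => ⋃ t ∈ Finset.Icc (N T) T, ⋃ k ∈ Finset.range (P T + 1),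
    {ω | A * Real.sqrt (P T * Real.log T / N T) ≤
      |empCov X (N T) T (t : ℕ) (k : ℕ) ω -
        ∫ ω', empCov X (N T) T (t : ℕ) (k : ℕ) ω' ∂μ|} with hbad
  -- At most T times and T lags, each failing with probability at most D/T⁴: the union bound is
  -- summable in T.
  have hev : ∀ᶠ T : ℕ in atTop, μ.real (bad T) ≤ D * (1 / (T : ℝ) ^ 2) := by
    filter_upwards [eventually_mul_log_rpow_mul_le hd hPN hR hR_log
        (4 * (-6 / Real.log δ + 2) ^ 2 * ((Real.exp 1 * c * 7 ^ d) ^ 2) ^ 2),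
      eventually_mul_log_rpow_mul_le hd hPN hR hR_log (-6 / Real.log δ + 2),
      eventually_mul_log_rpow_mul_le hd hPN hR hR_log 2,
      tendsto_log_natCast_atTop.eventually_ge_atTop 1,
      tendsto_log_natCast_atTop.eventually_ge_atTop ((1 + κ + 2 * A₀) ^ 2),
      eventually_ge_atTop 2] with T g1 g2 g3 l1 l2 hT
    obtain ⟨p1, p2, p3⟩ := hPN T hT
    have hT0 : (0 : ℝ) < T := by exact_mod_cast (by omega : 0 < T)
    have hone : ∀ t ∈ Finset.Icc (N T) T, ∀ k ∈ Finset.range (P T + 1),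
        μ.real {ω | A * Real.sqrt (P T * Real.log T / N T) ≤
          |empCov X (N T) T (t : ℕ) (k : ℕ) ω -
            ∫ ω', empCov X (N T) T (t : ℕ) (k : ℕ) ω' ∂μ|} ≤ D / T ^ 4 := by
      intro t ht k hk
      rw [Finset.mem_Icc] at ht
      rw [Finset.mem_range] at hk
      exact measureReal_abs_empCov_sub_ge_le (fun t => hX t T (by omega)) hd h.one_le_K h.δ_pos
        h.δ_lt_one h.κ_nonneg (h.alphaLE T (by omega)) (h.pow_eight T) hA₀ h.c_pos (h.moment T)
        (by omega) p2 p3 l1 l2 g1 g2 g3 (by exact_mod_cast ht.1) (by exact_mod_cast ht.2) (by omega)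
    have hcard1 : ((Finset.Icc (N T) T).card : ℝ) ≤ T := by
      rw [Nat.card_Icc]; exact_mod_cast (by omega)
    have hcard2 : ((Finset.range (P T + 1)).card : ℝ) ≤ T := by
      rw [Finset.card_range]; exact_mod_cast (by omega)
    calc μ.real (bad T) ≤ ∑ t ∈ Finset.Icc (N T) T, ∑ k ∈ Finset.range (P T + 1), D / T ^ 4 := by
          refine (measureReal_biUnion_finset_le _ _).trans (Finset.sum_le_sum fun t ht => ?_)
          exact (measureReal_biUnion_finset_le _ _).trans (Finset.sum_le_sum (hone t ht))
      _ = (Finset.Icc (N T) T).card * ((Finset.range (P T + 1)).card * (D / T ^ 4)) := by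
          rw [Finset.sum_const, Finset.sum_const, nsmul_eq_mul, nsmul_eq_mul]
      _ ≤ T * (T * (D / T ^ 4)) := by gcongr
      _ = D * (1 / (T : ℝ) ^ 2) := by field_simp
  have hsum : Summable fun T => μ.real (bad T) := by
    refine Summable.of_norm_bounded_eventually_nat
      (g := fun T : ℕ => D * (1 / (T : ℝ) ^ 2)) ?_ ?_
    · exact (Real.summable_one_div_nat_pow.2 one_lt_two).mul_left D
    · filter_upwards [hev] with T hT
      rwa [Real.norm_eq_abs, abs_of_nonneg measureReal_nonneg]
  have hsum' : ∑' T, μ (bad T) ≠ ⊤ := by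
    have e : ∀ T, μ (bad T) = ENNReal.ofReal (μ.real (bad T)) := fun T => by
      rw [ofReal_measureReal (measure_ne_top μ _)]
    simp only [e]
    rw [← ENNReal.ofReal_tsum_of_nonneg (fun T => measureReal_nonneg) hsum]
    exact ENNReal.ofReal_ne_top
  filter_upwards [ae_eventually_notMem hsum'] with ω hω
  filter_upwards [hω] with T hT t ht k hk
  by_contra hcon
  refine hT ?_
  simp only [hbad, Set.mem_iUnion, Finset.mem_Icc, Finset.mem_range, Set.mem_ofPred_eq]
  exact ⟨t, ht, k, by omega, (not_le.1 hcon).le⟩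

end AlmostSure

/-! ### Coercive matrices and perturbation of linear systems. -/

section LinearAlgebra

open Matrix

variable {p : ℕ}

/-- The Euclidean norm of a coordinate vector. -/
def enorm2 (x : Fin p → ℝ) : ℝ := ‖(WithLp.toLp 2 x : EuclideanSpace ℝ (Fin p))‖

theorem enorm2_sq (x : Fin p → ℝ) : enorm2 x ^ 2 = ∑ i, x i ^ 2 := by
  unfold enorm2
  rw [EuclideanSpace.real_norm_sq_eq]

theorem enorm2_nonneg (x : Fin p → ℝ) : 0 ≤ enorm2 x := norm_nonneg _

theorem dotProduct_le_enorm2_mul (x y : Fin p → ℝ) : |x ⬝ᵥ y| ≤ enorm2 x * enorm2 y := by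
  have h := abs_real_inner_le_norm (WithLp.toLp 2 x : EuclideanSpace ℝ (Fin p)) (WithLp.toLp 2 y)
  rw [EuclideanSpace.inner_toLp_toLp] at h
  rw [dotProduct_comm]
  simpa [enorm2] using h

theorem enorm2_sub_le (x y : Fin p → ℝ) : enorm2 (x - y) ≤ enorm2 x + enorm2 y := by
  unfold enorm2
  rw [WithLp.toLp_sub]
  exact norm_sub_le _ _

theorem sum_abs_le_sqrt_mul_enorm2 (x : Fin p → ℝ) : ∑ i, |x i| ≤ Real.sqrt p * enorm2 x := by
  have h := sq_sum_le_card_mul_sum_sq (s := (Finset.univ : Finset (Fin p))) (f := fun i => |x i|)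
  simp only [sq_abs, Finset.card_univ, Fintype.card_fin] at h
  rw [← enorm2_sq] at h
  have h0 : 0 ≤ Real.sqrt p * enorm2 x := mul_nonneg (Real.sqrt_nonneg _) (enorm2_nonneg x)
  refine (sq_le_sq₀ (Finset.sum_nonneg fun i _ => abs_nonneg _) h0).1 ?_
  rwa [mul_pow, Real.sq_sqrt (by positivity)]

theorem enorm2_le_sum_abs (x : Fin p → ℝ) : enorm2 x ≤ ∑ i, |x i| := by
  have h0 : 0 ≤ ∑ i, |x i| := Finset.sum_nonneg fun i _ => abs_nonneg _
  refine (sq_le_sq₀ (enorm2_nonneg x) h0).1 ?_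
  rw [enorm2_sq]
  simp only [← sq_abs (x _)]
  exact Finset.sum_sq_le_sq_sum_of_nonneg fun i _ => abs_nonneg _

theorem enorm2_le_of_abs_le {x : Fin p → ℝ} {ε : ℝ} (hε : 0 ≤ ε) (h : ∀ i, |x i| ≤ ε) :
    enorm2 x ≤ Real.sqrt p * ε := by
  refine (sq_le_sq₀ (enorm2_nonneg x) (by positivity)).1 ?_
  rw [enorm2_sq, mul_pow, Real.sq_sqrt (by positivity)]
  calc ∑ i, x i ^ 2 ≤ ∑ _i : Fin p, ε ^ 2 := Finset.sum_le_sum fun i _ => by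
        rw [← sq_abs]; exact pow_le_pow_left₀ (abs_nonneg _) (h i) 2
    _ = p * ε ^ 2 := by simp

/-- One factor √p comes from Cauchy–Schwarz in each row, the other from summing the p rows. This is
the factor that raises the rate from P^{1/2} to P^{3/2}. -/
theorem enorm2_mulVec_le {E : Matrix (Fin p) (Fin p) ℝ} {ε : ℝ} (hε : 0 ≤ ε)
    (h : ∀ i j, |E i j| ≤ ε) (x : Fin p → ℝ) : enorm2 (E *ᵥ x) ≤ p * ε * enorm2 x := by
  have h1 : ∀ i, |(E *ᵥ x) i| ≤ ε * (Real.sqrt p * enorm2 x) := by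
    intro i
    calc |(E *ᵥ x) i| ≤ ∑ j, |E i j * x j| :=
          Finset.abs_sum_le_sum_abs (fun j => E i j * x j) Finset.univ
      _ ≤ ∑ j, ε * |x j| := Finset.sum_le_sum fun j _ => by
          rw [abs_mul]; exact mul_le_mul_of_nonneg_right (h i j) (abs_nonneg _)
      _ = ε * ∑ j, |x j| := by rw [Finset.mul_sum]
      _ ≤ _ := mul_le_mul_of_nonneg_left (sum_abs_le_sqrt_mul_enorm2 x) hε
  have h0 := enorm2_nonneg x
  refine (enorm2_le_of_abs_le (by positivity) h1).trans (le_of_eq ?_)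
  have : Real.sqrt p * Real.sqrt p = p := Real.mul_self_sqrt (by positivity)
  calc _ = Real.sqrt p * Real.sqrt p * ε * enorm2 x := by ring
    _ = _ := by rw [this]

/-- The quadratic form of `M` is bounded below by `c` times the square of the norm. -/
def IsCoerciveMatrix (M : Matrix (Fin p) (Fin p) ℝ) (c : ℝ) : Prop :=
  ∀ x : Fin p → ℝ, c * enorm2 x ^ 2 ≤ x ⬝ᵥ (M *ᵥ x)

variable {M M' : Matrix (Fin p) (Fin p) ℝ} {c ε : ℝ}

theorem IsCoerciveMatrix.mono (h : IsCoerciveMatrix M c) {c' : ℝ} (hc : c' ≤ c) :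
    IsCoerciveMatrix M c' :=
  fun x => (mul_le_mul_of_nonneg_right hc (sq_nonneg _)).trans (h x)

/-- Cauchy–Schwarz applied to the quadratic form, then division by the norm of x. It yields
injectivity and bounds solutions without operator norms. -/
theorem IsCoerciveMatrix.mul_enorm2_le (h : IsCoerciveMatrix M c) (x : Fin p → ℝ) :
    c * enorm2 x ≤ enorm2 (M *ᵥ x) := by
  rcases (enorm2_nonneg x).eq_or_lt with h0 | h0
  · rw [← h0, mul_zero]; exact enorm2_nonneg _
  · have h1 := (h x).trans ((le_abs_self _).trans (dotProduct_le_enorm2_mul x (M *ᵥ x)))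
    rw [sq, ← mul_assoc, mul_comm (enorm2 x) (enorm2 (M *ᵥ x))] at h1
    exact le_of_mul_le_mul_right h1 h0

theorem IsCoerciveMatrix.isUnit (h : IsCoerciveMatrix M c) (hc : 0 < c) : IsUnit M := by
  rw [← Matrix.mulVec_injective_iff_isUnit]
  intro x y hxy
  have h1 := h.mul_enorm2_le (x - y)
  have h2 : M *ᵥ (x - y) = 0 := by rw [Matrix.mulVec_sub]; exact sub_eq_zero.2 hxy
  have h3 : enorm2 (0 : Fin p → ℝ) = 0 := by simp [enorm2]
  rw [h2, h3] at h1
  have h4 : enorm2 (x - y) = 0 :=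
    le_antisymm (nonpos_of_mul_nonpos_right h1 hc) (enorm2_nonneg _)
  unfold enorm2 at h4
  rw [norm_eq_zero, WithLp.toLp_eq_zero] at h4
  exact sub_eq_zero.1 h4

theorem IsCoerciveMatrix.perturb (h : IsCoerciveMatrix M c) (hε : 0 ≤ ε)
    (hM : ∀ i j, |M' i j - M i j| ≤ ε) : IsCoerciveMatrix M' (c - p * ε) := by
  intro x
  have h1 := h x
  have h2 := enorm2_mulVec_le (E := M' - M) hε hM x
  have h3 := (abs_le.1 (dotProduct_le_enorm2_mul x ((M' - M) *ᵥ x))).1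
  have h4 := mul_le_mul_of_nonneg_left h2 (enorm2_nonneg x)
  have e : x ⬝ᵥ (M' *ᵥ x) = x ⬝ᵥ (M *ᵥ x) + x ⬝ᵥ ((M' - M) *ᵥ x) := by
    rw [← dotProduct_add, ← Matrix.add_mulVec, add_sub_cancel]
  rw [e, sub_mul]
  have e2 : enorm2 x * (p * ε * enorm2 x) = p * ε * enorm2 x ^ 2 := by ring
  linarith

/-- Perturbation bound for the solution of a coercive linear system. -/
theorem IsCoerciveMatrix.enorm2_inv_mulVec_sub_le (h : IsCoerciveMatrix M c) (hc : 0 < c)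
    (hε : 0 ≤ ε) (hM : ∀ i j, |M' i j - M i j| ≤ ε) {v v' : Fin p → ℝ}
    (hv : ∀ i, |v' i - v i| ≤ ε) {V : ℝ} (hV : ∑ i, |v i| ≤ V) (hp : p * ε ≤ c / 2) :
    enorm2 (M'⁻¹ *ᵥ v' - M⁻¹ *ᵥ v) ≤ 2 / c * (1 + V / c) * (p * ε) := by
  have h' : IsCoerciveMatrix M' (c / 2) := (h.perturb hε hM).mono (by linarith)
  have hu := (Matrix.isUnit_iff_isUnit_det M).1 (h.isUnit hc)
  have hu' := (Matrix.isUnit_iff_isUnit_det M').1 (h'.isUnit (by linarith))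
  set a := M⁻¹ *ᵥ v with ha
  have hMa : M *ᵥ a = v := by
    rw [ha, Matrix.mulVec_mulVec, Matrix.mul_nonsing_inv _ hu, Matrix.one_mulVec]
  have hMa' : M' *ᵥ (M'⁻¹ *ᵥ v') = v' := by
    rw [Matrix.mulVec_mulVec, Matrix.mul_nonsing_inv _ hu', Matrix.one_mulVec]
  -- The error solves a system with matrix `M'`, whose coercivity constant is still c/2, and the
  -- perturbation `M' - M` hits only the fixed solution `a`, of norm at most V/c.
  have e : M' *ᵥ (M'⁻¹ *ᵥ v' - a) = (v' - v) - (M' - M) *ᵥ a := by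
    rw [Matrix.mulVec_sub, hMa', Matrix.sub_mulVec, hMa]; abel
  have h1 := h'.mul_enorm2_le (M'⁻¹ *ᵥ v' - a)
  rw [e] at h1
  have h2 := enorm2_le_of_abs_le (x := v' - v) hε hv
  have h3 := enorm2_mulVec_le (E := M' - M) hε hM a
  have h4 : enorm2 a ≤ V / c := by
    have := h.mul_enorm2_le a
    rw [hMa] at this
    rw [le_div_iff₀ hc, mul_comm]
    exact this.trans ((enorm2_le_sum_abs v).trans hV)
  have h5 : Real.sqrt p ≤ p := by
    rcases Nat.eq_zero_or_pos p with h | h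
    · simp [h]
    · have : (1 : ℝ) ≤ p := by exact_mod_cast h
      exact Real.sqrt_le_self_iff.2 (Or.inr this)
  have h6 : c / 2 * enorm2 (M'⁻¹ *ᵥ v' - a) ≤ p * ε + p * ε * (V / c) :=
    h1.trans ((enorm2_sub_le _ _).trans (add_le_add
      (h2.trans (mul_le_mul_of_nonneg_right h5 hε))
      (h3.trans (mul_le_mul_of_nonneg_left h4 (by positivity)))))
  have h7 : 2 / c * (1 + V / c) * (p * ε) = (p * ε + p * ε * (V / c)) / (c / 2) := by
    field_simp
  rw [h7, le_div_iff₀ (by linarith), mul_comm]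
  exact h6

end LinearAlgebra

/-! ### Toeplitz forms of the local spectral density. -/

section Spectral

open Matrix

/-- The real part of the local covariance function. -/
def realCov (f : ℝ → ℝ → ℝ) (k : ℤ) (u : ℝ) : ℝ :=
  ∫ θ in (-Real.pi)..Real.pi, Real.cos (k * θ) * f u θ

variable {f : ℝ → ℝ → ℝ}

theorem IsLocalSpectralDensity.intervalIntegrable (h : IsLocalSpectralDensity f) (u a b : ℝ) :
    IntervalIntegrable (f u) volume a b :=
  ((h.locallyIntegrable u).integrableOn_isCompact isCompact_uIcc).intervalIntegrable

theorem IsLocalSpectralDensity.intervalIntegrable_cos_mul (h : IsLocalSpectralDensity f)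
    (k : ℤ) (u a b : ℝ) :
    IntervalIntegrable (fun θ => Real.cos (k * θ) * f u θ) volume a b :=
  (h.intervalIntegrable u a b).continuousOn_mul (by fun_prop)

/-- The density is not assumed even in frequency, so `localCov` may be complex; covariances are
real, and comparing real parts suffices. -/
theorem re_localCov (h : IsLocalSpectralDensity f) (k : ℤ) (u : ℝ) :
    (localCov f k u).re = realCov f k u := by
  have hi : IntervalIntegrable (fun θ : ℝ =>
      Complex.exp (Complex.I * (k : ℂ) * (θ : ℂ)) * (f u θ : ℂ)) volume (-Real.pi) Real.pi :=
    IntervalIntegrable.continuousOn_mul (f := fun θ => (f u θ : ℂ))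
      ⟨(h.intervalIntegrable u _ _).1.ofReal, (h.intervalIntegrable u _ _).2.ofReal⟩ (by fun_prop)
  have e := Complex.reCLM.intervalIntegral_comp_comm hi
  rw [Complex.reCLM_apply] at e
  unfold localCov realCov
  rw [← e]
  refine intervalIntegral.integral_congr fun θ _ => ?_
  simp only [Complex.reCLM_apply, Complex.re_mul_ofReal]
  have e : Complex.I * (k : ℂ) * (θ : ℂ) = ((k * θ : ℝ) : ℂ) * Complex.I := by
    push_cast; ring
  rw [e, Complex.exp_ofReal_mul_I_re]

theorem abs_realCov_le (h : IsLocalSpectralDensity f) {M : ℝ} (hM : ∀ u θ, |f u θ| ≤ M) (k : ℤ)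
    (u : ℝ) : |realCov f k u| ≤ 2 * Real.pi * M := by
  rw [← re_localCov h]
  exact (Complex.abs_re_le_norm _).trans (norm_localCov_le hM k u)

theorem realCov_natAbs (k : ℤ) (u : ℝ) : realCov f (k.natAbs : ℤ) u = realCov f k u := by
  unfold realCov
  refine intervalIntegral.integral_congr fun θ _ => ?_
  congr 1
  rcases Int.natAbs_eq k with h | h
  · conv_rhs => rw [h]
  · conv_rhs => rw [h]
    rw [Int.cast_neg, neg_mul, Real.cos_neg]

theorem integral_cos_int_mul (n : ℤ) :
    ∫ θ in (-Real.pi)..Real.pi, Real.cos (n * θ) = if n = 0 then 2 * Real.pi else 0 := by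
  split_ifs with h
  · subst h
    simp
    ring
  · have h' : (n : ℝ) ≠ 0 := by exact_mod_cast h
    rw [intervalIntegral.integral_comp_mul_left _ h', integral_cos, mul_neg, Real.sin_neg,
      Real.sin_int_mul_pi]
    simp

/-- The Toeplitz matrix of the local covariances is bounded below by the spectral density. -/
theorem isCoerciveMatrix_realCov (h : IsLocalSpectralDensity f) {m₀ : ℝ}
    (hm : ∀ u θ, m₀ ≤ f u θ) (p : ℕ) (u : ℝ) :
    IsCoerciveMatrix (Matrix.of fun i j : Fin p => realCov f ((i : ℤ) - (j : ℤ)) u)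
      (2 * Real.pi * m₀) := by
  intro x
  -- This is |∑ x_j exp(ijθ)|² in real form; its nonnegativity lets the density be replaced by its
  -- lower bound.
  have hcos : ∀ θ : ℝ, ∑ i : Fin p, ∑ j : Fin p,
      x i * x j * Real.cos ((((i : ℤ) - (j : ℤ) : ℤ) : ℝ) * θ) =
      (∑ i : Fin p, x i * Real.cos (i * θ)) ^ 2 + (∑ i : Fin p, x i * Real.sin (i * θ)) ^ 2 := by
    intro θ
    rw [sq, sq, Finset.sum_mul_sum, Finset.sum_mul_sum, ← Finset.sum_add_distrib]
    refine Finset.sum_congr rfl fun i _ => ?_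
    rw [← Finset.sum_add_distrib]
    refine Finset.sum_congr rfl fun j _ => ?_
    push_cast
    rw [sub_mul, Real.cos_sub]
    ring
  have hquad : x ⬝ᵥ ((Matrix.of fun i j : Fin p => realCov f ((i : ℤ) - (j : ℤ)) u) *ᵥ x) =
      ∫ θ in (-Real.pi)..Real.pi, (∑ i : Fin p, ∑ j : Fin p,
        x i * x j * Real.cos ((((i : ℤ) - (j : ℤ) : ℤ) : ℝ) * θ)) * f u θ := by
    simp only [Finset.sum_mul, mul_assoc]
    have hi : ∀ i j : Fin p, IntervalIntegrable (fun θ => x i * (x j *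
        (Real.cos ((((i : ℤ) - (j : ℤ) : ℤ) : ℝ) * θ) * f u θ))) volume (-Real.pi) Real.pi :=
      fun i j => ((h.intervalIntegrable_cos_mul _ u _ _).const_mul _).const_mul _
    rw [intervalIntegral.integral_finsetSum fun i _ => by
      simpa only [Finset.sum_fn] using IntervalIntegrable.sum Finset.univ fun j _ => hi i j]
    simp only [dotProduct, mulVec, Matrix.of_apply, Finset.mul_sum]
    refine Finset.sum_congr rfl fun i _ => ?_
    rw [intervalIntegral.integral_finsetSum fun j _ => hi i j]
    refine Finset.sum_congr rfl fun j _ => ?_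
    rw [intervalIntegral.integral_const_mul, intervalIntegral.integral_const_mul]
    unfold realCov
    ring
  -- For a constant density, orthogonality of the cosines makes the Toeplitz matrix a multiple of
  -- the identity.
  have hone : ∫ θ in (-Real.pi)..Real.pi, (∑ i : Fin p, ∑ j : Fin p,
        x i * x j * Real.cos ((((i : ℤ) - (j : ℤ) : ℤ) : ℝ) * θ)) * m₀ =
      2 * Real.pi * m₀ * enorm2 x ^ 2 := by
    have hi : ∀ i j : Fin p, IntervalIntegrable (fun θ => x i * x j *
        Real.cos ((((i : ℤ) - (j : ℤ) : ℤ) : ℝ) * θ)) volume (-Real.pi) Real.pi :=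
      fun i j => Continuous.intervalIntegrable (by fun_prop) _ _
    rw [intervalIntegral.integral_mul_const, intervalIntegral.integral_finsetSum fun i _ => by
      simpa only [Finset.sum_fn] using IntervalIntegrable.sum Finset.univ fun j _ => hi i j,
      enorm2_sq, Finset.mul_sum, Finset.sum_mul]
    refine Finset.sum_congr rfl fun i _ => ?_
    rw [intervalIntegral.integral_finsetSum fun j _ => hi i j]
    have : ∀ j : Fin p, (∫ θ in (-Real.pi)..Real.pi, x i * x j *
        Real.cos ((((i : ℤ) - (j : ℤ) : ℤ) : ℝ) * θ)) =
        if i = j then x i * x j * (2 * Real.pi) else 0 := by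
      intro j
      rw [intervalIntegral.integral_const_mul, integral_cos_int_mul]
      by_cases hij : i = j
      · simp [hij]
      · have : ¬((i : ℤ) - (j : ℤ) = 0) := by
          intro h0
          exact hij (Fin.ext (by omega))
        simp [hij, this]
    simp only [this, Finset.sum_ite_eq, Finset.mem_univ, if_true]
    ring
  rw [hquad, ← hone]
  refine intervalIntegral.integral_mono_on (by linarith [Real.pi_pos])
    (Continuous.intervalIntegrable (by fun_prop) _ _)
    ((h.intervalIntegrable u _ _).continuousOn_mul (by fun_prop)) fun θ _ => ?_
  refine mul_le_mul_of_nonneg_left (hm u θ) ?_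
  rw [hcos]
  positivity

/-- Quadratic forms average linearly, so the lower bound survives although the local time varies
along the window. -/
theorem isCoerciveMatrix_average {p N : ℕ} (hN : 0 < N) {c : ℝ}
    {S : ℕ → Matrix (Fin p) (Fin p) ℝ} (hS : ∀ l, IsCoerciveMatrix (S l) c) :
    IsCoerciveMatrix (Matrix.of fun i j => (N : ℝ)⁻¹ * ∑ l ∈ Finset.range N, S l i j) c := by
  intro x
  have hN0 : (0 : ℝ) < N := by exact_mod_cast hN
  have e : x ⬝ᵥ ((Matrix.of fun i j => (N : ℝ)⁻¹ * ∑ l ∈ Finset.range N, S l i j) *ᵥ x) =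
      (N : ℝ)⁻¹ * ∑ l ∈ Finset.range N, x ⬝ᵥ (S l *ᵥ x) := by
    have e1 : (Matrix.of fun i j => (N : ℝ)⁻¹ * ∑ l ∈ Finset.range N, S l i j) =
        (N : ℝ)⁻¹ • ∑ l ∈ Finset.range N, S l := by
      ext i j
      simp [Matrix.sum_apply]
    rw [e1, Matrix.smul_mulVec, dotProduct_smul, smul_eq_mul, Matrix.sum_mulVec,
      dotProduct_sum]
  rw [e, ← div_eq_inv_mul, le_div_iff₀ hN0]
  calc c * enorm2 x ^ 2 * N = ∑ l ∈ Finset.range N, c * enorm2 x ^ 2 := by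
        rw [Finset.sum_const, Finset.card_range, nsmul_eq_mul, mul_comm]
    _ ≤ _ := Finset.sum_le_sum fun l _ => hS l x

end Spectral

/-! ### Means of the empirical autocovariances. -/

section Mean

variable {Ω : Type*} {mΩ : MeasurableSpace Ω} {μ : Measure Ω} {X : ℤ → ℕ → Ω → ℝ}
  {f : ℝ → ℝ → ℝ}

theorem empCov_natAbs (N T : ℕ) (t k : ℤ) (ω : Ω) :
    empCov X N T t (k.natAbs : ℤ) ω = empCov X N T t k ω := by
  have h1 : |((k.natAbs : ℤ) : ℝ)| = |(k : ℝ)| := by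
    rw [← Int.abs_eq_natAbs, Int.cast_abs, abs_abs]
  have h2 : |(k.natAbs : ℤ)| = |k| := by rw [← Int.abs_eq_natAbs, abs_abs]
  unfold empCov
  rw [h1, h2]

theorem integral_empCov {N T k : ℕ} (hk : k ≤ N) (t : ℤ)
    (hint : ∀ i ∈ Finset.range (N - k), Integrable
      (fun ω => X (t - N + k + 1 + i - k) T ω * X (t - N + k + 1 + i) T ω) μ) :
    ∫ ω, empCov X N T t k ω ∂μ = ((N : ℝ) - k)⁻¹ * ∑ i ∈ Finset.range (N - k),
      ∫ ω, X (t - N + k + 1 + i - k) T ω * X (t - N + k + 1 + i) T ω ∂μ := by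
  simp only [empCov_eq_sum_range hk]
  rw [integral_const_mul, integral_finsetSum _ hint]

theorem IsLocallyStationary.integrable_mul (h : IsLocallyStationary μ X f) {T : ℕ} (hT : 1 ≤ T)
    (s t : ℤ) : Integrable (fun ω => X s T ω * X t T ω) μ :=
  (h.finite_variance s T hT).integrable_mul (h.finite_variance t T hT)

/-- The mean of an empirical autocovariance is close to the average of the local covariances over
the whole window. -/
theorem abs_integral_empCov_sub_average_le [IsProbabilityMeasure μ]
    (h : IsLocallyStationary μ X f) (h_mean : ∀ (t : ℤ) (T : ℕ), 1 ≤ T → ∫ ω, X t T ω ∂μ = 0)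
    {C G : ℝ} (hC : 0 ≤ C) (hcov : ∀ (T : ℕ), 1 ≤ T → ∀ t k : ℤ,
      ‖((cov[X t T, X (t - k) T; μ] : ℝ) : ℂ) - localCov f k ((t : ℝ) / (T : ℝ))‖ ≤ C / (T : ℝ))
    (hG : ∀ k u, |realCov f k u| ≤ G) {N T P k : ℕ} (hP : 1 ≤ P) (hk : k ≤ P) (hPN : P < N)
    (hNT : N ≤ T) (t : ℤ) :
    |∫ ω, empCov X N T t k ω ∂μ - (N : ℝ)⁻¹ * ∑ l ∈ Finset.range N,
      realCov f k (((t - N + 1 + l : ℤ) : ℝ) / T)| ≤ (C + 2 * G) * P / N := by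
  have hT : 1 ≤ T := by omega
  have hkN : k ≤ N := by omega
  have hG0 : 0 ≤ G := (abs_nonneg _).trans (hG 0 0)
  have hN0 : (0 : ℝ) < N := by exact_mod_cast (by omega : 0 < N)
  have hkN' : (k : ℝ) < N := by exact_mod_cast (by omega : k < N)
  have hn0 : (0 : ℝ) < N - k := by linarith
  have hcast : ((N - k : ℕ) : ℝ) = N - k := by push_cast [hkN]; ring
  set g : ℕ → ℝ := fun l => realCov f k (((t - N + 1 + l : ℤ) : ℝ) / T) with hg
  set a : ℕ → ℝ := fun i =>
    ∫ ω, X (t - N + k + 1 + i - k) T ω * X (t - N + k + 1 + i) T ω ∂μ with ha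
  have hag : ∀ i, |a i - g (k + i)| ≤ C / N := by
    intro i
    have h1 := hcov T hT (t - N + k + 1 + i) k
    rw [covariance_eq_sub (h.finite_variance _ T hT) (h.finite_variance _ T hT),
      h_mean _ T hT, zero_mul, sub_zero] at h1
    have h2 := (Complex.abs_re_le_norm _).trans h1
    rw [Complex.sub_re, Complex.ofReal_re, re_localCov h.spectral] at h2
    have e1 : ∫ ω, (X (t - N + k + 1 + i) T * X (t - N + k + 1 + i - k) T) ω ∂μ = a i := by
      simp only [ha, Pi.mul_apply]
      congr 1
      ext ω
      ring
    have e2 : (t - N + 1 + ((k + i : ℕ) : ℤ) : ℤ) = t - N + k + 1 + i := by push_cast; ring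
    rw [e1] at h2
    simp only [hg]
    rw [e2]
    refine h2.trans (div_le_div_of_nonneg_left hC hN0 ?_)
    exact_mod_cast hNT
  rw [integral_empCov hkN t fun i _ => h.integrable_mul hT _ _]
  have hsplit : ∑ l ∈ Finset.range N, g l =
      ∑ l ∈ Finset.range k, g l + ∑ i ∈ Finset.range (N - k), g (k + i) := by
    rw [← Finset.sum_range_add]
    congr 2
    omega
  rw [hsplit]
  set H := ∑ l ∈ Finset.range k, g l with hH
  set Sg := ∑ i ∈ Finset.range (N - k), g (k + i) with hSg
  set Sa := ∑ i ∈ Finset.range (N - k), a i with hSa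
  have b1 : |Sa - Sg| ≤ (N - k) * (C / N) := by
    rw [hSa, hSg, ← Finset.sum_sub_distrib, ← hcast]
    refine (Finset.abs_sum_le_sum_abs _ _).trans ?_
    refine (Finset.sum_le_sum fun i _ => hag i).trans (le_of_eq ?_)
    rw [Finset.sum_const, Finset.card_range, nsmul_eq_mul]
  have b2 : |Sg| ≤ (N - k) * G := by
    rw [hSg, ← hcast]
    refine (Finset.abs_sum_le_sum_abs _ _).trans ?_
    refine (Finset.sum_le_sum fun i _ => hG _ _).trans (le_of_eq ?_)
    rw [Finset.sum_const, Finset.card_range, nsmul_eq_mul]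
  have b3 : |H| ≤ k * G := by
    rw [hH]
    refine (Finset.abs_sum_le_sum_abs _ _).trans ?_
    refine (Finset.sum_le_sum fun i _ => hG _ _).trans (le_of_eq ?_)
    rw [Finset.sum_const, Finset.card_range, nsmul_eq_mul]
  -- Three errors: covariances replaced by local ones, 1/(N - k) replaced by 1/N, and the `k` terms
  -- missing at the start of the window. Averaging over a window common to all lags is what produces
  -- an average of Toeplitz matrices.
  have e : ((N : ℝ) - k)⁻¹ * Sa - (N : ℝ)⁻¹ * (H + Sg) =
      (Sa - Sg) / (N - k) + k / (N * (N - k)) * Sg - H / N := by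
    field_simp
    ring
  rw [e]
  have c1 : |(Sa - Sg) / (N - k)| ≤ C / N := by
    rw [abs_div, abs_of_pos hn0, div_le_iff₀ hn0, mul_comm]
    exact b1
  have c2 : |k / (N * (N - k)) * Sg| ≤ k * G / N := by
    rw [abs_mul, abs_of_nonneg (by positivity)]
    refine (mul_le_mul_of_nonneg_left b2 (by positivity)).trans (le_of_eq ?_)
    field_simp
  have c3 : |H / N| ≤ k * G / N := by
    rw [abs_div, abs_of_pos hN0]
    exact div_le_div_of_nonneg_right b3 hN0.le
  have c4 : C / N + k * G / N + k * G / N ≤ (C + 2 * G) * P / N := by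
    rw [← add_div, ← add_div]
    refine div_le_div_of_nonneg_right ?_ hN0.le
    have hkP : (k : ℝ) ≤ P := by exact_mod_cast hk
    have hP' : (1 : ℝ) ≤ P := by exact_mod_cast hP
    nlinarith
  refine (abs_sub _ _).trans ?_
  refine (add_le_add_left (abs_add_le _ _) _).trans ?_
  linarith

/-- The means of the empirical autocovariances decay geometrically. -/
theorem HasUniformBounds.abs_integral_empCov_le [IsProbabilityMeasure μ] {d K δ κ A₀ c : ℝ}
    (hb : HasUniformBounds μ X d K δ κ A₀ c) (h : IsLocallyStationary μ X f)
    (h_mean : ∀ (t : ℤ) (T : ℕ), 1 ≤ T → ∫ ω, X t T ω ∂μ = 0)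
    {N T k : ℕ} (hk : k < N) {t : ℤ} (ht : N ≤ t) (htT : t ≤ T) :
    |∫ ω, empCov X N T t k ω ∂μ| ≤ (4 * K + 4 * (1 + κ) ^ 2) * δ ^ k := by
  have hT : 1 ≤ T := by omega
  have hkN' : (k : ℝ) < N := by exact_mod_cast hk
  have hn0 : (0 : ℝ) < N - k := by linarith
  have hcast : ((N - k : ℕ) : ℝ) = N - k := by push_cast [hk.le]; ring
  rw [integral_empCov hk.le t fun i _ => h.integrable_mul hT _ _, abs_mul,
    abs_of_pos (inv_pos.2 hn0), ← div_eq_inv_mul, div_le_iff₀ hn0, ← hcast]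
  refine (Finset.abs_sum_le_sum_abs _ _).trans ?_
  have hone : ∀ i ∈ Finset.range (N - k),
      |∫ ω, X (t - N + k + 1 + i - k) T ω * X (t - N + k + 1 + i) T ω ∂μ| ≤
        (4 * K + 4 * (1 + κ) ^ 2) * δ ^ k := by
    intro i hi
    have hi := Finset.mem_range.1 hi
    set l : ℤ := t - N + k + 1 + i with hl
    obtain ⟨u1, u2⟩ := hb.pow_four T (l - k) (by omega) (by omega)
    obtain ⟨v1, v2⟩ := hb.pow_four T l (by omega) (by omega)
    have hX : ∀ t, Measurable (X t T) := fun t => h.measurable t T hT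
    have hα := hb.alphaLE T hT (l - k) k
    rw [sub_add_cancel] at hα
    have := hα.abs_integral_mul_sub_le_of_pow_four (sigmaPast_le hX _) (sigmaFuture_le hX _)
      (pow_pos hb.δ_pos k) (measurable_sigmaPast le_rfl).stronglyMeasurable
      (measurable_sigmaFuture le_rfl).stronglyMeasurable u1 v1 u2 v2
    rwa [h_mean _ T hT, zero_mul, sub_zero] at this
  refine (Finset.sum_le_sum hone).trans (le_of_eq ?_)
  rw [Finset.sum_const, Finset.card_range, nsmul_eq_mul, mul_comm]

end Mean

/-! ### Uniform coercivity, boundedness of the mean vector and the rate. -/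

section Main

variable {Ω : Type*} {mΩ : MeasurableSpace Ω} {μ : Measure Ω} {X : ℤ → ℕ → Ω → ℝ}
  {f : ℝ → ℝ → ℝ} {P N : ℕ → ℕ}

/-- The matrices `E Γ̂` are eventually uniformly coercive. -/
theorem exists_eventually_isCoerciveMatrix_meanGamma [IsProbabilityMeasure μ]
    (h : IsLocallyStationary μ X f) (h_bounded : IsSpectrallyBounded f)
    (h_mean : ∀ (t : ℤ) (T : ℕ), 1 ≤ T → ∫ ω, X t T ω ∂μ = 0)
    (hPN : ∀ T : ℕ, 2 ≤ T → 2 ≤ 1 + P T ∧ 1 + P T ≤ N T ∧ N T ≤ T)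
    (hsq : ∀ ε : ℝ, 0 < ε → ∀ᶠ T : ℕ in atTop, (P T : ℝ) ^ 2 ≤ ε * N T) :
    ∃ c₀ : ℝ, 0 < c₀ ∧ ∀ᶠ T : ℕ in atTop, ∀ p ∈ Set.Icc 1 (P T), ∀ t : ℤ,
      IsCoerciveMatrix (meanGamma μ X p (N T) T t) c₀ := by
  obtain ⟨C, hC, hcov⟩ := h.cov_approx
  obtain ⟨m₀, M, hm₀, hM⟩ := h_bounded
  have hfm : ∀ u θ, m₀ ≤ f u θ := fun u θ => by
    have := (hM u θ).1
    rwa [abs_of_nonneg (h.spectral.nonneg u θ)] at this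
  have hG := abs_realCov_le h.spectral fun u θ => (hM u θ).2
  set G := 2 * Real.pi * M with hGdef
  have hG0 : 0 ≤ G := (abs_nonneg _).trans (hG 0 0)
  have hπm : 0 < Real.pi * m₀ := mul_pos Real.pi_pos hm₀
  refine ⟨Real.pi * m₀, hπm, ?_⟩
  -- Entrywise errors (C + 2G) P/N times the dimension p ≤ P may use up half of 2πm₀; the added 1
  -- keeps the denominator positive.
  filter_upwards [hsq (Real.pi * m₀ / (C + 2 * G + 1)) (by positivity), eventually_ge_atTop 2]
    with T h1 hT p hp t
  obtain ⟨p1, p2, p3⟩ := hPN T hT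
  have hN0 : (0 : ℝ) < N T := by exact_mod_cast (by omega : 0 < N T)
  have havg := isCoerciveMatrix_average (N := N T) (by omega)
    (S := fun l => Matrix.of fun i j : Fin p =>
      realCov f ((i : ℤ) - (j : ℤ)) (((t - N T + 1 + l : ℤ) : ℝ) / T))
    fun l => isCoerciveMatrix_realCov h.spectral hfm p _
  have hpert := havg.perturb (M' := meanGamma μ X p (N T) T t)
    (ε := (C + 2 * G) * P T / N T) (by positivity) (fun i j => by
      have hk : ((i : ℤ) - (j : ℤ)).natAbs ≤ P T := by
        have := hp.2
        omega
      have := abs_integral_empCov_sub_average_le h h_mean hC hcov hG (by omega) hk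
        (by omega) p3 t
      simp only [empCov_natAbs, realCov_natAbs] at this
      simpa only [meanGamma, empGamma, Matrix.of_apply] using this)
  refine hpert.mono ?_
  have hpP : (p : ℝ) ≤ P T := by exact_mod_cast hp.2
  have h2 : p * ((C + 2 * G) * P T / N T) ≤ Real.pi * m₀ := by
    rw [← mul_div_assoc, div_le_iff₀ hN0]
    calc (p : ℝ) * ((C + 2 * G) * P T) ≤ P T * ((C + 2 * G + 1) * P T) :=
          mul_le_mul hpP (mul_le_mul_of_nonneg_right (by linarith) (by positivity))
            (by positivity) (by positivity)
      _ = (C + 2 * G + 1) * (P T : ℝ) ^ 2 := by ring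
      _ ≤ (C + 2 * G + 1) * (Real.pi * m₀ / (C + 2 * G + 1) * N T) := by gcongr
      _ = Real.pi * m₀ * N T := by field_simp
  linarith

/-- Summing the geometric decay gives a bound free of `p`, so the population solution adds no power
of P to the rate. -/
theorem HasUniformBounds.sum_abs_meanGammaVec_le [IsProbabilityMeasure μ] {d K δ κ A₀ c : ℝ}
    (hb : HasUniformBounds μ X d K δ κ A₀ c) (h : IsLocallyStationary μ X f)
    (h_mean : ∀ (t : ℤ) (T : ℕ), 1 ≤ T → ∫ ω, X t T ω ∂μ = 0)
    {p N T : ℕ} (hp : p < N) {t : ℤ} (ht : N ≤ t) (htT : t ≤ T) :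
    ∑ i, |meanGammaVec μ X p N T t i| ≤ (4 * K + 4 * (1 + κ) ^ 2) * (1 - δ)⁻¹ := by
  have hK0 : 0 < K := by linarith [hb.one_le_K]
  have hδ := hb.δ_pos
  have hδ1 := hb.δ_lt_one
  calc ∑ i, |meanGammaVec μ X p N T t i| ≤
        ∑ i : Fin p, (4 * K + 4 * (1 + κ) ^ 2) * δ ^ (i : ℕ) := by
        refine Finset.sum_le_sum fun i _ => ?_
        have h1 := hb.abs_integral_empCov_le h h_mean (k := i + 1) (by omega) ht htT
        have h2 : δ ^ ((i : ℕ) + 1) ≤ δ ^ (i : ℕ) :=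
          pow_le_pow_of_le_one hδ.le hδ1.le (by omega)
        simp only [meanGammaVec, empGammaVec]
        push_cast at h1
        exact h1.trans (mul_le_mul_of_nonneg_left h2 (by positivity))
    _ = (4 * K + 4 * (1 + κ) ^ 2) * ∑ i ∈ Finset.range p, δ ^ i := by
        rw [← Finset.mul_sum, Fin.sum_univ_eq_sum_range (fun i => δ ^ i)]
    _ ≤ _ := by
        refine mul_le_mul_of_nonneg_left ?_ (by positivity)
        have := sum_pow_tsub_le hδ hδ1 p 0
        simpa using this

/-- The rate of the estimator, written as a square root. -/
theorem rpow_mul_rpow_eq_sqrt {a b n : ℝ} (ha : 0 ≤ a) :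
    a ^ ((3 : ℝ) / 2) * (b / n) ^ ((1 : ℝ) / 2) = Real.sqrt (a ^ 3 * b / n) := by
  have e : a ^ ((3 : ℝ) / 2) = Real.sqrt (a ^ 3) := by
    rw [Real.sqrt_eq_rpow, ← Real.rpow_natCast, ← Real.rpow_mul ha]
    norm_num
  rw [e, ← Real.sqrt_eq_rpow, ← Real.sqrt_mul (by positivity), mul_div_assoc]

theorem mul_sqrt_eq_sqrt {a b n : ℝ} (ha : 0 ≤ a) :
    a * Real.sqrt (a * b / n) = Real.sqrt (a ^ 3 * b / n) := by
  have e : a ^ 3 * b / n = a ^ 2 * (a * b / n) := by ring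
  rw [e, Real.sqrt_mul (by positivity), Real.sqrt_sq ha]

theorem maxError_nonneg (μ : Measure Ω) (X : ℤ → ℕ → Ω → ℝ) (P N T : ℕ) (ω : Ω) :
    0 ≤ maxError μ X P N T ω :=
  Real.iSup_nonneg fun _ => Real.iSup_nonneg fun _ => norm_nonneg _

end Main

end LocStat

end

/-- Strong uniform consistency of the localised Yule–Walker estimator with diverging order. The
first two conjuncts say that the matrices inverted in `ā` and, almost surely, in `â` are
invertible for all large `T`, so that no conventional value of an inverse is involved; the third is the almost sure rate, and
the fourth the strong uniform consistency that it expresses. -/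
theorem corollary6p2 {Ω : Type*} [MeasurableSpace Ω] (μ : Measure Ω) [IsProbabilityMeasure μ]
    (X : ℤ → ℕ → Ω → ℝ) (f : ℝ → ℝ → ℝ) (d : ℝ)
    (h_stat : LocStat.IsLocallyStationary μ X f)
    (h_mixing : LocStat.IsGeometricallyMixing μ X)
    (h_bounded : LocStat.IsSpectrallyBounded f)
    (h_smooth : LocStat.IsSpectrallySmooth f)
    (h_moment : LocStat.BernsteinCondition μ X d)
    (h_mean : ∀ (t : ℤ) (T : ℕ), 1 ≤ T → ∫ ω, X t T ω ∂μ = 0)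
    (P N : ℕ → ℕ)
    (hPN : ∀ T : ℕ, 2 ≤ T → 2 ≤ 1 + P T ∧ 1 + P T ≤ N T ∧ N T ≤ T)
    (hP : (fun T : ℕ => (P T : ℝ)) =o[atTop]
      fun T : ℕ => (N T : ℝ) ^ ((1 + 2 * d) / (4 + 6 * d)))
    (hN : Tendsto N atTop atTop)
    (R : ℕ → ℝ) (hR_nonneg : ∀ T, 0 ≤ R T) (hR : Tendsto R atTop atTop)
    (hR_log : (fun T : ℕ => R T * Real.log (T : ℝ)) =o[atTop]
      fun T : ℕ => ((N T : ℝ) / (P T : ℝ)) ^ (1 / (3 + 4 * d))) :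
    (∀ᶠ T : ℕ in atTop, ∀ p ∈ Set.Icc 1 (P T), ∀ t ∈ Set.Icc (N T) T,
      IsUnit (LocStat.meanGamma μ X p (N T) T (t : ℤ))) ∧
    (∀ᵐ ω ∂μ, ∀ᶠ T : ℕ in atTop, ∀ p ∈ Set.Icc 1 (P T), ∀ t ∈ Set.Icc (N T) T,
      IsUnit (LocStat.empGamma X p (N T) T (t : ℤ) ω)) ∧
    (∀ᵐ ω ∂μ, (fun T : ℕ => LocStat.maxError μ X (P T) (N T) T ω) =O[atTop]
      fun T : ℕ => (P T : ℝ) ^ ((3 : ℝ) / 2) *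
        (Real.log (T : ℝ) / (N T : ℝ)) ^ ((1 : ℝ) / 2)) ∧
    (∀ᵐ ω ∂μ, Tendsto (fun T : ℕ => LocStat.maxError μ X (P T) (N T) T ω) atTop (nhds 0)) := by
  have hd : 1 / 2 ≤ d := h_moment.1
  obtain ⟨K, δ, κ, A₀, c, hb⟩ :=
    LocStat.exists_hasUniformBounds h_stat h_mixing h_bounded h_moment
  obtain ⟨A, hA, hdev⟩ := LocStat.exists_ae_eventually_abs_empCov_sub_le hb hd
    h_stat.measurable hPN hR hR_log
  obtain ⟨c₀, hc₀, hcoer⟩ := LocStat.exists_eventually_isCoerciveMatrix_meanGamma h_stat h_bounded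
    h_mean hPN fun ε hε => LocStat.eventually_sq_le hd hPN hP hε
  set V := (4 * K + 4 * (1 + κ) ^ 2) * (1 - δ)⁻¹ with hV
  have hV0 : 0 ≤ V := by
    have h1 := hb.one_le_K
    have h2 : 0 < (1 - δ)⁻¹ := inv_pos.2 (by linarith [hb.δ_lt_one])
    positivity
  have hrate : ∀ T : ℕ, (P T : ℝ) ^ ((3 : ℝ) / 2) *
      (Real.log (T : ℝ) / (N T : ℝ)) ^ ((1 : ℝ) / 2) =
      P T * Real.sqrt (P T * Real.log T / N T) := fun T => by
    rw [LocStat.rpow_mul_rpow_eq_sqrt (by positivity),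
      LocStat.mul_sqrt_eq_sqrt (by positivity)]
  have hsmall : ∀ ε : ℝ, 0 < ε → ∀ᶠ T : ℕ in atTop,
      P T * Real.sqrt (P T * Real.log T / N T) ≤ ε := by
    intro ε hε
    filter_upwards [LocStat.eventually_cube_mul_log_le hd hPN hP hR hR_log (pow_pos hε 2),
      eventually_ge_atTop 2] with T h1 hT
    have hN0 : (0 : ℝ) < N T := by
      have := hPN T hT
      exact_mod_cast (by omega : 0 < N T)
    rw [LocStat.mul_sqrt_eq_sqrt (by positivity)]
    refine Real.sqrt_le_iff.2 ⟨hε.le, ?_⟩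
    rwa [div_le_iff₀ hN0]
  have hzero : Tendsto (fun T : ℕ => (P T : ℝ) ^ ((3 : ℝ) / 2) *
      (Real.log (T : ℝ) / (N T : ℝ)) ^ ((1 : ℝ) / 2)) atTop (nhds 0) := by
    simp only [hrate]
    rw [Metric.tendsto_nhds]
    intro ε hε
    filter_upwards [hsmall (ε / 2) (by positivity)] with T hT
    rw [Real.dist_eq, sub_zero, abs_of_nonneg (by positivity)]
    linarith
  -- These are the hypotheses of the perturbation bound, uniform in p and t on one almost sure
  -- event; the first holds because P √(P log T / N) tends to 0.
  have hentries : ∀ᵐ ω ∂μ, ∀ᶠ T : ℕ in atTop, ∀ p ∈ Set.Icc 1 (P T), ∀ t ∈ Set.Icc (N T) T,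
      (p * (A * Real.sqrt (P T * Real.log T / N T)) ≤ c₀ / 2) ∧
      (∀ i j, |LocStat.empGamma X p (N T) T (t : ℤ) ω i j -
        LocStat.meanGamma μ X p (N T) T (t : ℤ) i j| ≤
          A * Real.sqrt (P T * Real.log T / N T)) ∧
      (∀ i, |LocStat.empGammaVec X p (N T) T (t : ℤ) ω i -
        LocStat.meanGammaVec μ X p (N T) T (t : ℤ) i| ≤
          A * Real.sqrt (P T * Real.log T / N T)) := by
    filter_upwards [hdev] with ω hω
    filter_upwards [hω, hsmall (c₀ / (2 * A)) (by positivity)] with T h1 h2 p hp t ht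
    refine ⟨?_, fun i j => ?_, fun i => ?_⟩
    · have hpP : (p : ℝ) ≤ P T := by exact_mod_cast hp.2
      calc (p : ℝ) * (A * Real.sqrt (P T * Real.log T / N T))
          ≤ P T * (A * Real.sqrt (P T * Real.log T / N T)) := by gcongr
        _ = A * (P T * Real.sqrt (P T * Real.log T / N T)) := by ring
        _ ≤ A * (c₀ / (2 * A)) := by gcongr
        _ = c₀ / 2 := by field_simp
    · have hk : ((i : ℤ) - (j : ℤ)).natAbs ≤ P T := by
        have := hp.2
        omega
      have := h1 t ht _ hk
      simp only [LocStat.empCov_natAbs] at this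
      simpa only [LocStat.meanGamma, LocStat.empGamma, Matrix.of_apply] using this
    · have hk : (i : ℕ) + 1 ≤ P T := by
        have := hp.2
        omega
      have := h1 t ht _ hk
      push_cast at this
      simpa only [LocStat.meanGammaVec, LocStat.empGammaVec] using this
  have hbig : ∀ᵐ ω ∂μ, (fun T : ℕ => LocStat.maxError μ X (P T) (N T) T ω) =O[atTop]
      fun T : ℕ => (P T : ℝ) ^ ((3 : ℝ) / 2) *
        (Real.log (T : ℝ) / (N T : ℝ)) ^ ((1 : ℝ) / 2) := by
    filter_upwards [hentries] with ω hω
    refine IsBigO.of_bound (2 / c₀ * (1 + V / c₀) * A) ?_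
    filter_upwards [hω, hcoer, eventually_ge_atTop 2] with T h1 h2 hT
    obtain ⟨p1, p2, p3⟩ := hPN T hT
    have hnn : 0 ≤ 2 / c₀ * (1 + V / c₀) * A *
        (P T * Real.sqrt (P T * Real.log T / N T)) := by positivity
    rw [hrate, Real.norm_eq_abs, abs_of_nonneg (LocStat.maxError_nonneg _ _ _ _ _ _),
      Real.norm_eq_abs, abs_of_nonneg (by positivity)]
    -- `Real.iSup_le` asks for a nonnegative bound because a real supremum over an empty index set
    -- is 0.
    refine Real.iSup_le (fun p => Real.iSup_le (fun t => ?_) hnn) hnn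
    obtain ⟨e1, e2, e3⟩ := h1 p p.2 t t.2
    have hpP : ((p : ℕ) : ℝ) ≤ P T := by exact_mod_cast p.2.2
    have hpN : (p : ℕ) < N T := by
      have := p.2.2
      omega
    have hvec := hb.sum_abs_meanGammaVec_le h_stat h_mean hpN
      (t := ((t : ℕ) : ℤ)) (by exact_mod_cast t.2.1) (T := T) (by exact_mod_cast t.2.2)
    have := (h2 p p.2 t).enorm2_inv_mulVec_sub_le hc₀ (by positivity) e2 e3 hvec e1
    unfold LocStat.enorm2 at this
    rw [WithLp.toLp_sub] at this
    refine this.trans ?_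
    calc 2 / c₀ * (1 + V / c₀) * ((p : ℕ) * (A * Real.sqrt (P T * Real.log T / N T)))
        ≤ 2 / c₀ * (1 + V / c₀) * (P T * (A * Real.sqrt (P T * Real.log T / N T))) := by
          gcongr
      _ = _ := by ring
  refine ⟨?_, ?_, hbig, ?_⟩
  · filter_upwards [hcoer] with T h1 p hp t _
    exact (h1 p hp t).isUnit hc₀
  · filter_upwards [hentries] with ω hω
    filter_upwards [hω, hcoer] with T h1 h2 p hp t ht
    obtain ⟨e1, e2, -⟩ := h1 p hp t ht
    -- The sample matrix keeps at least c₀ - pε ≥ c₀/2 of the coercivity of its mean.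
    exact (((h2 p hp t).perturb (by positivity) e2).mono
      (by linarith : c₀ / 2 ≤ _)).isUnit (by positivity)
  · filter_upwards [hbig] with ω hω
    exact hω.trans_tendsto hzero
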